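/- **Setting.** Let $H\in(0,1)$, let $X=(X(t))_{t\in\mathbb R}$ be a fractional Brownian motion with Hurst exponent $H$ (centered Gaussian, a.s. continuous paths, covariance $\frac v2(|s|^{2H}+|t|^{2H}-|s-t|^{2H})$ for some $v>0$), and let $\psi$ be a mother wavelet with $\int(1+|t|)|\psi(t)|\,dt<\infty$ and $\int\psi=0$. The nondecimated wavelet coefficient of $X$ at level $j$ and location $k$ is $$\int X(t)\,2^{j/2}\psi\big(2^j(t-k)\big)\,dt .$$ Let $\sigma^2>0$ be the variance of the coefficients of level $0$ (it does not depend on the location), and put $\lambda_j=\sigma^2 2^{-(2H+1)j}$. Let $M\ge1$ (number of groups) and $J$ (number of levels) be fixed, $\alpha\in[0,1]$, $p\in(0,1/2)$. For sample sizes $N\to\infty$ with $2M\mid N$, let $d_{j,k}$ ($1\le j\le J$, $1\le k\le N$) be random variables, depending also on $N$, such that each $d_{j,k}$ has the distribution of the wavelet coefficient of $X$ at level $j$ and location $k$ (for instance, they are these coefficients). Let $$D_{j,k}=\tfrac12\big(d_{j,k}^2+d_{j,k+N/2}^2\big),\qquad 1\le k\le N/2,$$ and assume that, for all $j$ and $k$,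 $d_{j,k}$ and $d_{j,k+N/2}$ are independent and that, for all $j$ and all $1\le i\le M$, the $n=N/(2M)$ mid-energies $D_{j,i},D_{j,i+M},\dots,D_{j,N/2-M+i}$ of the $i$-th group are mutually independent. For a sample of size $n$ let $Y_q$ be its $\lfloor nq\rfloor$-th smallest element, and let $\hat\mu_{j,i}=\frac\alpha2Y_p+(1-\alpha)Y_{1/2}+\frac\alpha2Y_{1-p}$ be the general trimean estimator computed from the sample $\log D_{j,i},\log D_{j,i+M},\dots,\log D_{j,N/2-M+i}$. Define $$c(\alpha,p)=\tfrac\alpha2\log\Big(\log\tfrac1{1-p}\cdot\log\tfrac1p\Big)+(1-\alpha)\log\log2,$$ $$f(\alpha,p)=\frac{\alpha^2}{4}\,g_1(p)+\frac{\alpha(1-\alpha)}2\,g_2(p)+\frac{(1-\alpha)^2}{(\log2)^2},$$ $$g_1(p)=\frac p{(1-p)(\log(1-p))^2}+\frac{1-p}{p(\log p)^2}+\frac{2p}{(1-p)\log(1-p)\log p},$$ $$g_2(p)=\frac{2p}{(1-p)\log(1-p)\log\frac12}+\frac2{\log\frac12\,\log p}.$$ **Theorem.** (a) $f(\alpha,p)>0$,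 and for all $1\le j\le J$ and $1\le i\le M$ the estimator $\hat\mu_{j,i}$ is asymptotically normal with mean $c(\alpha,p)+\log\lambda_j$ and variance $\frac{2M}Nf(\alpha,p)$, that is, $$\sqrt{\tfrac N{2M}}\,\Big(\hat\mu_{j,i}-c(\alpha,p)-\log\lambda_j\Big)\ \longrightarrow\ \mathcal N\big(0,f(\alpha,p)\big)\quad\text{in distribution as }N\to\infty .$$ (b) The Hurst exponent can be estimated from the slopes: let $S\subseteq\{1,\dots,J\}$ be a set of at least two levels, $\hat\beta_i$ the slope of the least squares regression line through the points $(j,\hat\mu_{j,i})$, $j\in S$, and $\bar\beta=\frac1M\sum_{i=1}^M\hat\beta_i$. Then $$\hat H:=\frac1M\sum_{i=1}^M\Big(-\frac{\hat\beta_i}{2\log2}-\frac12\Big)=-\frac{\bar\beta}{2\log2}-\frac12,$$ and $\hat H$ is a consistent estimator of $H$: $\hat H\to H$ in probability as $N\to\infty$. -/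

import Mathlib

open MeasureTheory ProbabilityTheory Filter Topology

noncomputable section

namespace GTLME

/-- `X` is a (two-sided) fractional Brownian motion with Hurst exponent `H` and
variance `v` at time one: a centered Gaussian process with covariance
`(v / 2) (|s|^{2H} + |t|^{2H} - |s - t|^{2H})` and almost surely continuous paths. -/
structure IsFractionalBrownianMotion {Ω : Type*} [MeasurableSpace Ω]
    (H v : ℝ) (X : ℝ → Ω → ℝ) (P : Measure Ω) : Prop where
  gaussian : IsGaussianProcess X P
  mean_eq_zero : ∀ t, ∫ ω, X t ω ∂P = 0
  covariance_eq : ∀ s t, cov[X s, X t; P] =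
    v / 2 * (|s| ^ (2 * H) + |t| ^ (2 * H) - |s - t| ^ (2 * H))
  continuous_paths : ∀ᵐ ω ∂P, Continuous (fun t => X t ω)

/-- Requirements on the mother wavelet: `∫ (1 + |t|) |ψ(t)| dt < ∞` and `∫ ψ = 0`.
Every compactly supported wavelet (Haar, Daubechies, Pollen) satisfies them. -/
structure IsMotherWavelet (ψ : ℝ → ℝ) : Prop where
  integrable : Integrable ψ
  integrable_mul : Integrable (fun t => t * ψ t)
  integral_eq_zero : ∫ t, ψ t = 0

/-- The nondecimated wavelet atom `ψ_{j,k}(t) = 2^{j/2} ψ(2^j (t - k))`: the shift does not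
depend on the level. -/
def atom (ψ : ℝ → ℝ) (j k : ℕ) (t : ℝ) : ℝ :=
  (2 : ℝ) ^ ((j : ℝ) / 2) * ψ ((2 : ℝ) ^ j * (t - k))

/-- The nondecimated wavelet coefficient of the process `X` at level `j` and location `k`. -/
def ndwtCoeff {Ω : Type*} (ψ : ℝ → ℝ) (X : ℝ → Ω → ℝ) (j k : ℕ) (ω : Ω) : ℝ :=
  ∫ t, X t ω * atom ψ j k t

/-- The mid-energy `D_k = (d_k² + d_{k+N/2}²) / 2` of one level `d` of `N` coefficients. -/
def midEnergy {Ω : Type*} (N : ℕ) (d : ℕ → Ω → ℝ) (k : ℕ) (ω : Ω) : ℝ :=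
  (d k ω ^ 2 + d (k + N / 2) ω ^ 2) / 2

/-- The `r`-th order statistic `x_{r:n}`, `1 ≤ r ≤ n` (the `r`-th smallest of `n` numbers). -/
def orderStat {n : ℕ} (x : Fin n → ℝ) (r : ℕ) : ℝ :=
  if h : r - 1 < n then x (Tuple.sort x ⟨r - 1, h⟩) else 0

/-- The sample `q`-th quantile `Y_q = x_{⌊nq⌋:n}`. -/
def sampleQuantile {n : ℕ} (x : Fin n → ℝ) (q : ℝ) : ℝ :=
  orderStat x ⌊(n : ℝ) * q⌋₊

/-- The general trimean estimator `(α/2) Y_p + (1 - α) Y_{1/2} + (α/2) Y_{1-p}`. -/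
def generalTrimean {n : ℕ} (α p : ℝ) (x : Fin n → ℝ) : ℝ :=
  α / 2 * sampleQuantile x p + (1 - α) * sampleQuantile x (1 / 2)
    + α / 2 * sampleQuantile x (1 - p)

/-- The `i`-th subgroup of mid-energies `D_i, D_{i+M}, …, D_{N/2-M+i}`. -/
def groupEnergy {Ω : Type*} (N M : ℕ) (d : ℕ → Ω → ℝ) (i : ℕ)
    (r : Fin (N / 2 / M)) (ω : Ω) : ℝ :=
  midEnergy N d (i + M * r) ω

/-- The general trimean estimator of the `i`-th subgroup of logged mid-energies
`log D_i, log D_{i+M}, …, log D_{N/2-M+i}`. -/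
def logTrimean {Ω : Type*} (α p : ℝ) (N M : ℕ) (d : ℕ → Ω → ℝ) (i : ℕ) (ω : Ω) : ℝ :=
  generalTrimean α p (fun r => Real.log (groupEnergy N M d i r ω))

/-- The slope of the ordinary least squares line through the points `(j, y j)`, `j ∈ S`. -/
def olsSlope (S : Finset ℕ) (y : ℕ → ℝ) : ℝ :=
  (∑ j ∈ S, ((j : ℝ) - (∑ l ∈ S, (l : ℝ)) / S.card) * (y j - (∑ l ∈ S, y l) / S.card)) /
    ∑ j ∈ S, ((j : ℝ) - (∑ l ∈ S, (l : ℝ)) / S.card) ^ 2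

/-- The slope `β̂_i` of the regression on the pairs `(j, μ̂_{j,i})`, `j ∈ S`;
`d j k` is the coefficient at level `j` and location `k`. -/
def groupSlope {Ω : Type*} (α p : ℝ) (S : Finset ℕ) (N M : ℕ) (d : ℕ → ℕ → Ω → ℝ)
    (i : ℕ) (ω : Ω) : ℝ :=
  olsSlope S (fun j => logTrimean α p N M (d j) i ω)

/-- The average slope `β̄` over the `M` groups. -/
def meanSlope {Ω : Type*} (α p : ℝ) (S : Finset ℕ) (N M : ℕ) (d : ℕ → ℕ → Ω → ℝ)
    (ω : Ω) : ℝ :=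
  (1 / (M : ℝ)) * ∑ i ∈ Finset.Icc 1 M, groupSlope α p S N M d i ω

/-- The estimator `Ĥ = (1/M) ∑ᵢ Ĥ_i` with `Ĥ_i = - β̂_i / (2 log 2) - 1/2`. -/
def hurstEstimator {Ω : Type*} (α p : ℝ) (S : Finset ℕ) (N M : ℕ) (d : ℕ → ℕ → Ω → ℝ)
    (ω : Ω) : ℝ :=
  (1 / (M : ℝ)) * ∑ i ∈ Finset.Icc 1 M,
    (-(groupSlope α p S N M d i ω) / (2 * Real.log 2) - 1 / 2)

/-- `c(α, p)`. -/
def cConst (α p : ℝ) : ℝ :=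
  α / 2 * Real.log (Real.log (1 / (1 - p)) * Real.log (1 / p))
    + (1 - α) * Real.log (Real.log 2)

/-- `g₁(p)`. -/
def g₁ (p : ℝ) : ℝ :=
  p / ((1 - p) * Real.log (1 - p) ^ 2) + (1 - p) / (p * Real.log p ^ 2)
    + 2 * p / ((1 - p) * Real.log (1 - p) * Real.log p)

/-- `g₂(p)`. -/
def g₂ (p : ℝ) : ℝ :=
  2 * p / ((1 - p) * Real.log (1 - p) * Real.log (1 / 2))
    + 2 / (Real.log (1 / 2) * Real.log p)

/-- `f(α, p)`. -/
def fConst (α p : ℝ) : ℝ :=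
  α ^ 2 / 4 * g₁ p + α * (1 - α) / 2 * g₂ p + (1 - α) ^ 2 / Real.log 2 ^ 2

/-- `λ_j = σ² 2^{-(2H+1)j}`. -/
def levelScale (H σ : ℝ) (j : ℕ) : ℝ :=
  σ ^ 2 * (2 : ℝ) ^ (-((2 * H + 1) * (j : ℝ)))

end GTLME
end

open GTLME

namespace GTLME

/-! A wavelet coefficient is a pathwise integral of `X`. It agrees almost surely with a Bochner
integral in `Lp ℝ 2 P`, hence lies in the closed span of the variables `X t` and is centered
Gaussian. Since `ψ` has integral zero, `X` may be replaced by its increments from `k`, and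
stationarity and self-similarity of these give the variance `levelScale H σ j` exactly
(`map_ndwtCoeff`). Half the sum of squares of two independent such Gaussians is exponential with
this mean, by polar coordinates. Hence each group of logged mid-energies is an i.i.d. sample from
the log-exponential law translated by `log λ_j` (`map_log_midEnergy`). The trimean commutes with
translations, so only one law has to be studied, with distribution function `1 - exp(-exp t)`.

A sample quantile is not a sum, but Bahadur's representation (`bahadur`) replaces it by an average
of influence functions, with an error `o(n^{-1/2})` in probability. By Ghosh's lemma
(`tendstoZeroInProb_sub_of_levels`) the two sides need only be compared at fixed levels. There the
event that a quantile is at most `x` concerns the number of sample points below `x`, and Chebyshev's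
inequality suffices. The trimean thus behaves like an average of bounded centered i.i.d. variables:
the central limit theorem gives normality, the covariances `q(1-q')/(f f')` add up to `fConst`, and
Chebyshev gives consistency.

Finally `log λ_j` is affine in `j` with slope `-(2H+1) log 2`. The error of the Hurst estimator is
therefore a fixed linear combination of trimean errors, each tending to zero in probability. -/

/-! ### Gaussianity of pathwise integrals -/

/-- A process with almost surely continuous paths agrees almost surely with a process all of whose
paths are continuous and all of whose marginals are measurable. -/
lemma exists_continuous_modification {Ω : Type*} [MeasurableSpace Ω] {P : Measure Ω}
    {X : ℝ → Ω → ℝ} (hX : ∀ t, AEMeasurable (X t) P)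
    (hc : ∀ᵐ ω ∂P, Continuous fun t => X t ω) :
    ∃ Y : ℝ → Ω → ℝ, (∀ t, Measurable (Y t)) ∧ (∀ ω, Continuous fun t => Y t ω) ∧
      ∀ᵐ ω ∂P, ∀ t, Y t ω = X t ω := by
  classical
  have h1 : ∀ᵐ ω ∂P, ∀ q : ℚ, X q ω = (hX q).mk (X q) ω :=
    ae_all_iff.2 fun q => (hX q).ae_eq_mk
  -- `G` is a measurable set of full measure on which the path is continuous and equals a measurable
  -- version at every rational time. Off `G` the new process is zero; at a real time it is a limit
  -- of measurable functions along rationals.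
  obtain ⟨G, hGs, hGm, hG⟩ := (hc.and h1).exists_measurable_mem
  refine ⟨fun t => G.indicator (X t), fun t => ?_, fun ω => ?_, ?_⟩
  · have hseq : ∃ u : ℕ → ℚ, Tendsto (fun n => (u n : ℝ)) atTop (𝓝 t) := by
      have := Rat.denseRange_cast (𝕜 := ℝ) t
      rw [mem_closure_iff_seq_limit] at this
      obtain ⟨x, hx, hx'⟩ := this
      choose u hu using hx
      exact ⟨u, by simpa [hu] using hx'⟩
    obtain ⟨u, hu⟩ := hseq
    refine measurable_of_tendsto_metrizable (f := fun n => G.indicator ((hX (u n)).mk (X (u n))))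
      (fun n => (hX (u n)).measurable_mk.indicator hGm) ?_
    rw [tendsto_pi_nhds]
    intro ω
    by_cases hω : ω ∈ G
    · simp only [Set.indicator_of_mem hω, ← (hG ω hω).2]
      exact ((hG ω hω).1.tendsto t).comp hu
    · simp [Set.indicator_of_notMem hω]
  · by_cases hω : ω ∈ G
    · simpa only [Set.indicator_of_mem hω] using (hG ω hω).1
    · simp only [Set.indicator_of_notMem hω]
      exact continuous_const
  · filter_upwards [hGs] with ω hω t
    simp [Set.indicator_of_mem hω]

/-- A Bochner integral in `L²` is almost surely the pathwise integral. -/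
lemma coeFn_integral_Lp_two {Ω : Type*} [MeasurableSpace Ω] {P : Measure Ω} [IsProbabilityMeasure P]
    {u : ℝ → Ω → ℝ} (hu : AEStronglyMeasurable (Function.uncurry u) (volume.prod P))
    {Φ : ℝ → Lp ℝ 2 P} (hΦ : ∀ t, Φ t =ᵐ[P] u t) (hi : Integrable Φ) :
    Integrable (fun ω => ∫ t, u t ω) P ∧
    (fun ω => ∫ t, u t ω) =ᵐ[P] (∫ t, Φ t : Lp ℝ 2 P) := by
  have hint : Integrable (Function.uncurry u) (volume.prod P) := by
    rw [integrable_prod_iff hu]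
    have hL1 : ∀ t, Integrable (u t) P := fun t =>
      (((Lp.memLp (Φ t)).integrable (by norm_num)).congr (hΦ t))
    refine ⟨ae_of_all _ hL1, ?_⟩
    refine hi.norm.mono' ?_ (ae_of_all _ fun t => ?_)
    · exact hu.norm.integral_prod_right'
    · have h0 : 0 ≤ ∫ ω, ‖Function.uncurry u (t, ω)‖ ∂P := integral_nonneg fun _ => norm_nonneg _
      rw [Real.norm_of_nonneg h0]
      have h2 : MemLp (u t) 2 P := (memLp_congr_ae (hΦ t)).1 (Lp.memLp (Φ t))
      rw [Lp.norm_def, eLpNorm_congr_ae (hΦ t)]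
      -- On a probability space the L¹ norm is at most the L² norm, so integrability of `Φ` in L²
      -- gives integrability on the product, and Fubini applies.
      have h3 : eLpNorm (u t) 1 P ≤ eLpNorm (u t) 2 P :=
        eLpNorm_le_eLpNorm_of_exponent_le (by norm_num) h2.1
      have h4 := ENNReal.toReal_mono h2.2.ne h3
      refine le_trans (le_of_eq ?_) h4
      rw [eLpNorm_one_eq_lintegral_enorm]
      simp only [Function.uncurry]
      rw [integral_norm_eq_lintegral_enorm h2.1]
  have hI : Integrable (fun ω => ∫ t, u t ω) P := hint.integral_prod_right
  refine ⟨hI, ?_⟩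
  refine Integrable.ae_eq_of_forall_setIntegral_eq _ _ hI
    ((Lp.memLp _).integrable (by norm_num)) fun s hs hμs => ?_
  -- Integration over `s` is the inner product with an indicator, a continuous functional, so it
  -- passes under the Bochner integral; Fubini does the same for the pathwise integral.
  have e1 : ∀ f : Lp ℝ 2 P, ∫ ω in s, f ω ∂P = innerSL ℝ (indicatorConstLp 2 hs hμs.ne (1 : ℝ)) f :=
    fun f => by
      rw [innerSL_apply_apply, L2.inner_indicatorConstLp_one]
  rw [e1, ← ContinuousLinearMap.integral_comp_comm _ hi]
  simp_rw [← e1]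
  have hint' : Integrable (Function.uncurry u) (volume.prod (P.restrict s)) := by
    refine hint.mono_measure ?_
    rw [← Measure.restrict_univ (μ := (volume : Measure ℝ)), Measure.prod_restrict]
    exact (Measure.restrict_le_self).trans (by rw [Measure.restrict_univ])
  rw [← integral_integral_swap hint']
  refine integral_congr_ae (ae_of_all _ fun t => ?_)
  exact integral_congr_ae (ae_restrict_of_ae (hΦ t).symm)

/-- The squared norm of a Bochner integral. -/
lemma norm_integral_sq_eq {E : Type*} [NormedAddCommGroup E] [InnerProductSpace ℝ E]
    [CompleteSpace E] {f : ℝ → E} (hf : Integrable f) :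
    ‖∫ t, f t‖ ^ 2 = ∫ s, ∫ t, inner ℝ (f s) (f t) := by
  have h (c : E) : ∫ t, inner ℝ c (f t) = inner ℝ c (∫ t, f t) := by
    simpa using ContinuousLinearMap.integral_comp_comm (innerSL ℝ c) hf
  rw [← real_inner_self_eq_norm_sq]
  simp_rw [h]
  simp_rw [real_inner_comm (∫ t, f t)]
  rw [h]

/-- A Bochner integral belongs to every closed subspace that contains the integrand. -/
lemma integral_mem_of_isClosed {E : Type*} [NormedAddCommGroup E] [InnerProductSpace ℝ E]
    [CompleteSpace E] {f : ℝ → E} (hf : Integrable f) (K : Submodule ℝ E)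
    (hK : IsClosed (K : Set E)) (h : ∀ t, f t ∈ K) : ∫ t, f t ∈ K := by
  have : CompleteSpace K := hK.completeSpace_coe
  -- A closed subspace is its double orthogonal complement, so membership is tested by inner
  -- products, which commute with the integral.
  rw [← Submodule.orthogonal_orthogonal K, Submodule.mem_orthogonal]
  intro y hy
  have e : ∫ t, inner ℝ y (f t) = inner ℝ y (∫ t, f t) := by
    simpa using ContinuousLinearMap.integral_comp_comm (innerSL ℝ y) hf
  rw [← e]
  simp [fun t => Submodule.inner_left_of_mem_orthogonal (h t) hy]

/-- `L²` limits of centered Gaussian variables are centered Gaussian. -/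
lemma map_eq_gaussianReal_of_mem_closure {Ω : Type*} [MeasurableSpace Ω] {P : Measure Ω}
    [IsProbabilityMeasure P] (S : Set (Lp ℝ 2 P))
    (hS : ∀ Z ∈ S, P.map Z = gaussianReal 0 (‖Z‖ ^ 2).toNNReal) {Z : Lp ℝ 2 P}
    (hZ : Z ∈ closure S) : P.map Z = gaussianReal 0 (‖Z‖ ^ 2).toNNReal := by
  obtain ⟨z, hzS, hz⟩ := mem_closure_iff_seq_limit.1 hZ
  have hm : ∀ Z : Lp ℝ 2 P, AEMeasurable Z P := fun Z => (Lp.aestronglyMeasurable Z).aemeasurable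
  have h1 := (tendstoInMeasure_of_tendsto_Lp hz).tendstoInDistribution_of_aemeasurable
    (fun i => hm (z i)) (hm Z)
  have h2 := ProbabilityMeasure.tendsto_iff_tendsto_charFun.1 h1.tendsto
  have : IsProbabilityMeasure (P.map Z) := Measure.isProbabilityMeasure_map (hm Z)
  refine Measure.ext_of_charFun (funext fun t => ?_)
  refine tendsto_nhds_unique (h2 t) ?_
  simp only [ProbabilityMeasure.coe_mk]
  simp_rw [hS _ (hzS _), charFun_gaussianReal]
  have h3 : Tendsto (fun n => ((‖z n‖ ^ 2).toNNReal : ℂ)) atTop (𝓝 ((‖Z‖ ^ 2).toNNReal : ℂ)) := by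
    have h4 : Tendsto (fun n => (((‖z n‖ ^ 2 : ℝ)) : ℂ)) atTop (𝓝 ((‖Z‖ ^ 2 : ℝ) : ℂ)) :=
      (Complex.continuous_ofReal.tendsto _).comp (hz.norm.pow 2)
    have h5 : ∀ x : ℝ, (((x ^ 2).toNNReal : NNReal) : ℂ) = ((x ^ 2 : ℝ) : ℂ) := fun x => by
      rw [← NNReal.coe_inj.2 rfl]
      have := Real.coe_toNNReal (x ^ 2) (by positivity)
      exact congrArg Complex.ofReal this
    simpa only [h5] using h4
  refine (Complex.continuous_exp.tendsto _).comp ?_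
  exact tendsto_const_nhds.sub ((h3.mul tendsto_const_nhds).div_const _)

/-- Finite linear combinations of a Gaussian process are Gaussian, and for mean zero the variance is
the squared L² norm. This is the dense set from which the limit lemma above starts. -/
lemma map_eq_gaussianReal_of_mem_span {Ω : Type*} [MeasurableSpace Ω] {P : Measure Ω}
    [IsProbabilityMeasure P] {Y : ℝ → Ω → ℝ} (hG : IsGaussianProcess Y P)
    (h0 : ∀ t, ∫ ω, Y t ω ∂P = 0) {Φ : ℝ → Lp ℝ 2 P} (hΦ : ∀ t, Φ t =ᵐ[P] Y t)
    {Z : Lp ℝ 2 P} (hZ : Z ∈ Submodule.span ℝ (Set.range Φ)) :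
    P.map Z = gaussianReal 0 (‖Z‖ ^ 2).toNNReal := by
  obtain ⟨c, rfl⟩ := (Finsupp.mem_span_range_iff_exists_finsupp).1 hZ
  have hZ : (c.sum fun i a => a • Φ i : Lp ℝ 2 P) =ᵐ[P]
      fun ω => ∑ t ∈ c.support, c t • Y t ω := by
    have h1 : ∀ t, (c t • Φ t : Lp ℝ 2 P) =ᵐ[P] fun ω => c t • Y t ω := fun t => by
      filter_upwards [Lp.coeFn_smul (c t) (Φ t), hΦ t] with ω h1 h2
      rw [h1, Pi.smul_apply, h2]
    have h2 := Lp.coeFn_finsetSum c.support fun t => c t • Φ t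
    refine h2.trans ?_
    have h3 : ∀ᵐ ω ∂P, ∀ t ∈ c.support, (c t • Φ t : Lp ℝ 2 P) ω = c t • Y t ω :=
      (ae_ball_iff c.support.countable_toSet).2 fun t _ => h1 t
    filter_upwards [h3] with ω hω
    rw [Finset.sum_apply]
    exact Finset.sum_congr rfl hω
  set Z := (c.sum fun i a => a • Φ i : Lp ℝ 2 P)
  have hg : HasGaussianLaw Z P :=
    ((hG.smul c).hasGaussianLaw_fun_sum (I := c.support)).congr hZ.symm
  have hY1 : ∀ t, Integrable (Y t) P := fun t => (hG.hasGaussianLaw_eval t).memLp_two.integrable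
    (by norm_num)
  have hm : ∫ ω, Z ω ∂P = 0 := by
    simp only [smul_eq_mul] at hZ
    rw [integral_congr_ae hZ, integral_finsetSum _ fun t _ => (hY1 t).const_mul (c t)]
    simp [integral_const_mul, h0]
  rw [hg.map_eq_gaussianReal, hm, variance_of_integral_eq_zero hg.aemeasurable hm]
  congr 2
  rw [← real_inner_self_eq_norm_sq, L2.inner_def]
  simp [pow_two]

/-- Integrals of a centered Gaussian process with continuous paths are centered Gaussian. -/
lemma map_integral_eq_gaussianReal {Ω : Type*} [MeasurableSpace Ω] {P : Measure Ω}
    [IsProbabilityMeasure P] {X : ℝ → Ω → ℝ} (hG : IsGaussianProcess X P)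
    (h0 : ∀ t, ∫ ω, X t ω ∂P = 0) (hc : ∀ᵐ ω ∂P, Continuous fun t => X t ω)
    {Φ : ℝ → Lp ℝ 2 P} (hΦ : ∀ t, Φ t =ᵐ[P] X t) {a : ℝ → ℝ}
    (ha : AEStronglyMeasurable a) (hi : Integrable fun t => a t • Φ t) :
    AEMeasurable (fun ω => ∫ t, X t ω * a t) P ∧
    P.map (fun ω => ∫ t, X t ω * a t) = gaussianReal 0 (‖∫ t, a t • Φ t‖ ^ 2).toNNReal := by
  obtain ⟨Y, hYm, hYc, hYX⟩ := exists_continuous_modification hG.aemeasurable hc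
  have hYX' : ∀ t, X t =ᵐ[P] Y t := fun t => by
    filter_upwards [hYX] with ω h using (h t).symm
  have hYu : Measurable (Function.uncurry Y) :=
    measurable_uncurry_of_continuous_of_measurable hYc hYm
  have hu : AEStronglyMeasurable (Function.uncurry fun t ω => Y t ω * a t) (volume.prod P) :=
    hYu.aestronglyMeasurable.mul ha.comp_fst
  have hΦ' : ∀ t, (a t • Φ t : Lp ℝ 2 P) =ᵐ[P] fun ω => Y t ω * a t := fun t => by
    filter_upwards [Lp.coeFn_smul (a t) (Φ t), hΦ t, hYX' t] with ω h1 h2 h3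
    rw [h1, Pi.smul_apply, h2, h3, smul_eq_mul, mul_comm]
  obtain ⟨h1, h2⟩ := coeFn_integral_Lp_two hu hΦ' hi
  have h3 : (fun ω => ∫ t, X t ω * a t) =ᵐ[P] fun ω => ∫ t, Y t ω * a t := by
    filter_upwards [hYX] with ω h
    simp only [h]
  refine ⟨h1.aemeasurable.congr h3.symm, ?_⟩
  rw [Measure.map_congr (h3.trans h2)]
  let S := Submodule.span ℝ (Set.range Φ)
  refine map_eq_gaussianReal_of_mem_closure (S : Set (Lp ℝ 2 P))
    (fun Z hZ => map_eq_gaussianReal_of_mem_span hG h0 hΦ hZ) ?_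
  rw [← Submodule.topologicalClosure_coe, SetLike.mem_coe]
  refine integral_mem_of_isClosed hi _ S.isClosed_topologicalClosure fun t => ?_
  exact Submodule.smul_mem _ _ (S.le_topologicalClosure (Submodule.subset_span ⟨t, rfl⟩))

/-! ### Exact scaling of the wavelet coefficients -/

/-- The covariance of fractional Brownian motion. -/
noncomputable def fbmCov (H v s t : ℝ) : ℝ :=
  v / 2 * (|s| ^ (2 * H) + |t| ^ (2 * H) - |s - t| ^ (2 * H))

lemma fbmCov_mul {H v c : ℝ} (hc : 0 ≤ c) (s t : ℝ) :
    fbmCov H v (c * s) (c * t) = c ^ (2 * H) * fbmCov H v s t := by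
  unfold fbmCov
  rw [← mul_sub, abs_mul, abs_mul, abs_mul, abs_of_nonneg hc, Real.mul_rpow hc (abs_nonneg _),
    Real.mul_rpow hc (abs_nonneg _), Real.mul_rpow hc (abs_nonneg _)]
  ring

/-- Stationarity of increments, in covariance form. The case `H = 0` must be excluded because `0 ^ 0
= 1`. -/
lemma fbmCov_increment (H v k s t : ℝ) (hH : H ≠ 0) :
    fbmCov H v (k + s) (k + t) - fbmCov H v (k + s) k - fbmCov H v k (k + t) + fbmCov H v k k
      = fbmCov H v s t := by
  unfold fbmCov
  have h : (2 * H) ≠ 0 := by simpa using hH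
  have e1 : k + s - (k + t) = s - t := by ring
  have e2 : k + s - k = s := by ring
  have e3 : k - (k + t) = -t := by ring
  rw [e1, e2, e3, abs_neg, sub_self, abs_zero, Real.zero_rpow h]
  ring

/-- The mean-square version of a process with the covariance of fractional Brownian motion. -/
lemma norm_sub_sq_of_fbmCov {E : Type*} [NormedAddCommGroup E] [InnerProductSpace ℝ E]
    {H v : ℝ} (hH : H ≠ 0) {Φ : ℝ → E} (hΦ : ∀ s t, inner ℝ (Φ s) (Φ t) = fbmCov H v s t)
    (s t : ℝ) : ‖Φ s - Φ t‖ ^ 2 = v * |s - t| ^ (2 * H) := by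
  rw [← real_inner_self_eq_norm_sq]
  simp only [inner_sub_left, inner_sub_right, hΦ, fbmCov]
  have h : (2 * H) ≠ 0 := by simpa using hH
  rw [sub_self, sub_self, abs_zero, Real.zero_rpow h, abs_sub_comm t s]
  ring

lemma norm_sub_of_fbmCov {E : Type*} [NormedAddCommGroup E] [InnerProductSpace ℝ E]
    {H v : ℝ} (hH : 0 < H) (hv : 0 ≤ v) {Φ : ℝ → E}
    (hΦ : ∀ s t, inner ℝ (Φ s) (Φ t) = fbmCov H v s t) (s t : ℝ) :
    ‖Φ s - Φ t‖ = √v * |s - t| ^ H := by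
  have h := norm_sub_sq_of_fbmCov hH.ne' hΦ s t
  have h2 : (√v * |s - t| ^ H) ^ 2 = v * |s - t| ^ (2 * H) := by
    rw [mul_pow, Real.sq_sqrt hv, ← Real.rpow_natCast, ← Real.rpow_mul (abs_nonneg _)]
    congr 2
    push_cast
    ring
  rw [← h2] at h
  exact (pow_left_inj₀ (norm_nonneg _) (by positivity) (by norm_num)).1 h

lemma continuous_of_fbmCov {E : Type*} [NormedAddCommGroup E] [InnerProductSpace ℝ E]
    {H v : ℝ} (hH : 0 < H) (hv : 0 ≤ v) {Φ : ℝ → E}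
    (hΦ : ∀ s t, inner ℝ (Φ s) (Φ t) = fbmCov H v s t) : Continuous Φ := by
  rw [continuous_iff_continuousAt]
  intro s
  rw [ContinuousAt, tendsto_iff_norm_sub_tendsto_zero]
  simp_rw [norm_sub_of_fbmCov hH hv hΦ]
  have hc : Continuous fun t : ℝ => √v * |t - s| ^ H :=
    continuous_const.mul ((continuous_id.sub continuous_const).abs.rpow_const fun _ => Or.inr hH.le)
  have := hc.tendsto s
  simpa [Real.zero_rpow hH.ne'] using this

/-- The norm of `Φ t` grows like `|t| ^ H ≤ 1 + |t|`, which the first moment of `a` absorbs; this is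
where `H ≤ 1` enters. -/
lemma integrable_smul_of_fbmCov {E : Type*} [NormedAddCommGroup E] [InnerProductSpace ℝ E]
    [SecondCountableTopologyEither ℝ E]
    {H v : ℝ} (hH : 0 < H) (hH' : H ≤ 1) (hv : 0 ≤ v) {Φ : ℝ → E}
    (hΦ : ∀ s t, inner ℝ (Φ s) (Φ t) = fbmCov H v s t) {a : ℝ → ℝ} (ha : Integrable a)
    (ha' : Integrable fun t => t * a t) : Integrable fun t => a t • Φ t := by
  have hc := continuous_of_fbmCov hH hv hΦ
  have hb : Integrable fun t => (√v + ‖Φ 0‖) * |a t| + √v * |t * a t| :=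
    (ha.abs.const_mul _).add (ha'.abs.const_mul _)
  refine hb.mono' (ha.1.smul hc.aestronglyMeasurable) (ae_of_all _ fun t => ?_)
  have h1 : |t| ^ H ≤ 1 + |t| := by
    rcases le_total |t| 1 with h | h
    · exact (Real.rpow_le_one (abs_nonneg _) h hH.le).trans (by linarith [abs_nonneg t])
    · calc |t| ^ H ≤ |t| ^ (1 : ℝ) := Real.rpow_le_rpow_of_exponent_le h hH'
        _ = |t| := Real.rpow_one _
        _ ≤ 1 + |t| := by linarith
  have h2 : ‖Φ t‖ ≤ √v * (1 + |t|) + ‖Φ 0‖ := by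
    have := norm_sub_of_fbmCov hH hv hΦ t 0
    rw [sub_zero] at this
    have h3 : ‖Φ t‖ ≤ ‖Φ t - Φ 0‖ + ‖Φ 0‖ := by simpa using norm_add_le (Φ t - Φ 0) (Φ 0)
    refine h3.trans ?_
    rw [this]
    gcongr
  rw [norm_smul, Real.norm_eq_abs, abs_mul]
  nlinarith [mul_le_mul_of_nonneg_left h2 (abs_nonneg (a t))]

lemma IsMotherWavelet.integrable_atom {ψ : ℝ → ℝ} (hψ : IsMotherWavelet ψ) (j k : ℕ) :
    Integrable (atom ψ j k) := by
  unfold atom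
  exact ((hψ.integrable.comp_mul_left' (by positivity : (2 : ℝ) ^ j ≠ 0)).comp_sub_right
    (k : ℝ)).const_mul _

lemma IsMotherWavelet.integrable_mul_atom {ψ : ℝ → ℝ} (hψ : IsMotherWavelet ψ) (j k : ℕ) :
    Integrable fun t => t * atom ψ j k t := by
  have h1 := ((hψ.integrable_mul.comp_mul_left' (by positivity : (2 : ℝ) ^ j ≠ 0)).comp_sub_right
    (k : ℝ)).const_mul (((2 : ℝ) ^ j)⁻¹ * (2 : ℝ) ^ ((j : ℝ) / 2))
  refine (h1.add ((hψ.integrable_atom j k).const_mul k)).congr (ae_of_all _ fun t => ?_)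
  simp only [atom, Pi.add_apply]
  field_simp
  ring

lemma IsMotherWavelet.integral_atom {ψ : ℝ → ℝ} (hψ : IsMotherWavelet ψ) (j k : ℕ) :
    ∫ t, atom ψ j k t = 0 := by
  unfold atom
  rw [integral_const_mul, integral_sub_right_eq_self (fun t => ψ ((2 : ℝ) ^ j * t)),
    Measure.integral_comp_mul_left, hψ.integral_eq_zero]
  simp

/-- The wavelet coefficient of a mean-square fractional Brownian motion scales exactly. -/
lemma norm_integral_atom_sq {E : Type*} [NormedAddCommGroup E] [InnerProductSpace ℝ E]
    [CompleteSpace E] {H v : ℝ} (hH : 0 < H) (hH' : H ≤ 1) (hv : 0 ≤ v) {Φ : ℝ → E}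
    (hΦ : ∀ s t, inner ℝ (Φ s) (Φ t) = fbmCov H v s t) {ψ : ℝ → ℝ} (hψ : IsMotherWavelet ψ)
    (j k : ℕ) :
    ‖∫ t, atom ψ j k t • Φ t‖ ^ 2 = (2 : ℝ) ^ (-((2 * H + 1) * (j : ℝ))) *
      ∫ s, ∫ t, ψ s * ψ t * fbmCov H v s t := by
  set c : ℝ := (2 : ℝ) ^ j with hc
  have hc0 : 0 < c := by positivity
  -- Subtracting `Φ k` is free because the atom has integral zero. The rescaled increments again
  -- have a fractional Brownian covariance, with `v` multiplied by `2^{-2Hj}`.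
  let Ψ : ℝ → E := fun x => Φ (k + c⁻¹ * x) - Φ k
  have hΨ : ∀ s t, inner ℝ (Ψ s) (Ψ t) = fbmCov H (c⁻¹ ^ (2 * H) * v) s t := fun s t => by
    simp only [Ψ, inner_sub_left, inner_sub_right, hΦ]
    have h1 := fbmCov_increment H v k (c⁻¹ * s) (c⁻¹ * t) hH.ne'
    rw [fbmCov_mul (by positivity)] at h1
    have h2 : fbmCov H (c⁻¹ ^ (2 * H) * v) s t = c⁻¹ ^ (2 * H) * fbmCov H v s t := by
      unfold fbmCov; ring
    rw [h2, ← h1]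
    ring
  have hi1 := integrable_smul_of_fbmCov hH hH' hv hΦ (hψ.integrable_atom j k)
    (hψ.integrable_mul_atom j k)
  have hi2 := integrable_smul_of_fbmCov hH hH' (by positivity) hΨ hψ.integrable hψ.integrable_mul
  have e1 : ∫ t, atom ψ j k t • Φ t = (c⁻¹ * (2 : ℝ) ^ ((j : ℝ) / 2)) • ∫ x, ψ x • Ψ x := by
    have e2 : ∫ t, atom ψ j k t • Φ t = ∫ t, atom ψ j k t • (Φ t - Φ k) := by
      simp_rw [smul_sub]
      rw [integral_sub hi1 ((hψ.integrable_atom j k).smul_const _), integral_smul_const,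
        hψ.integral_atom, zero_smul, sub_zero]
    have e3 : ∀ t, atom ψ j k t • (Φ t - Φ k) =
        (fun y => (fun x => (2 : ℝ) ^ ((j : ℝ) / 2) • (ψ x • Ψ x)) (c * y)) (t - k) := fun t => by
      simp only [atom, Ψ, ← hc, inv_mul_cancel_left₀ hc0.ne', add_sub_cancel, smul_smul]
    rw [e2]
    simp_rw [e3]
    rw [integral_sub_right_eq_self
        (fun y => (fun x => (2 : ℝ) ^ ((j : ℝ) / 2) • (ψ x • Ψ x)) (c * y)),
      Measure.integral_comp_mul_left (fun x => (2 : ℝ) ^ ((j : ℝ) / 2) • (ψ x • Ψ x)) c,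
      integral_smul, smul_smul, abs_of_pos (by positivity)]
  rw [e1, norm_smul, mul_pow, norm_integral_sq_eq hi2]
  simp only [real_inner_smul_left, real_inner_smul_right, hΨ]
  have e4 : ∀ s t, ψ t * (ψ s * fbmCov H (c⁻¹ ^ (2 * H) * v) s t)
      = c⁻¹ ^ (2 * H) * (ψ s * ψ t * fbmCov H v s t) := fun s t => by
    unfold fbmCov; ring
  simp_rw [e4, integral_const_mul]
  rw [← mul_assoc]
  congr 1
  -- The Jacobian and the normalization give `(2^{-j} 2^{j/2})² = 2^{-j}`; with `2^{-2Hj}` from the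
  -- covariance this is `2^{-(2H+1)j}`.
  rw [Real.norm_of_nonneg (by positivity), mul_pow, hc, ← Real.rpow_natCast 2 j,
    ← Real.rpow_neg (by norm_num), ← Real.rpow_natCast, ← Real.rpow_natCast (_ ^ _) 2,
    ← Real.rpow_mul (by norm_num), ← Real.rpow_mul (by norm_num), ← Real.rpow_mul (by norm_num),
    ← Real.rpow_add (by norm_num), ← Real.rpow_add (by norm_num)]
  congr 1
  push_cast
  ring

/-- The law of a wavelet coefficient of fractional Brownian motion. -/
theorem map_ndwtCoeff {Ω : Type*} [MeasurableSpace Ω] {P : Measure Ω} [IsProbabilityMeasure P]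
    {H v : ℝ} (hH : 0 < H) (hH' : H < 1) (hv : 0 < v) {X : ℝ → Ω → ℝ}
    (hX : IsFractionalBrownianMotion H v X P) {ψ : ℝ → ℝ} (hψ : IsMotherWavelet ψ)
    {σ : ℝ} {k₀ : ℕ} (hσX : Var[ndwtCoeff ψ X 0 k₀; P] = σ ^ 2) (j k : ℕ) :
    AEMeasurable (ndwtCoeff ψ X j k) P ∧
      P.map (ndwtCoeff ψ X j k) = gaussianReal 0 (levelScale H σ j).toNNReal := by
  have hL : ∀ t, MemLp (X t) 2 P := fun t => (hX.gaussian.hasGaussianLaw_eval t).memLp_two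
  let Φ : ℝ → Lp ℝ 2 P := fun t => (hL t).toLp
  have hΦ : ∀ t, Φ t =ᵐ[P] X t := fun t => (hL t).coeFn_toLp
  have hin : ∀ s t, inner ℝ (Φ s) (Φ t) = fbmCov H v s t := fun s t => by
    rw [fbmCov, ← hX.covariance_eq, covariance_eq_sub (hL s) (hL t), hX.mean_eq_zero,
      hX.mean_eq_zero, L2.inner_def, zero_mul, sub_zero]
    refine integral_congr_ae ?_
    filter_upwards [hΦ s, hΦ t] with ω h1 h2
    simp [h1, h2, mul_comm]
  have key : ∀ j k, AEMeasurable (ndwtCoeff ψ X j k) P ∧ P.map (ndwtCoeff ψ X j k) =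
      gaussianReal 0 ((2 : ℝ) ^ (-((2 * H + 1) * (j : ℝ))) *
        ∫ s, ∫ t, ψ s * ψ t * fbmCov H v s t).toNNReal := fun j k => by
    rw [← norm_integral_atom_sq hH hH'.le hv.le hin hψ j k]
    exact map_integral_eq_gaussianReal hX.gaussian hX.mean_eq_zero hX.continuous_paths hΦ
      (hψ.integrable_atom j k).1 (integrable_smul_of_fbmCov hH hH'.le hv.le hin
        (hψ.integrable_atom j k) (hψ.integrable_mul_atom j k))
  -- Nonnegativity is needed to read the integral off the variance, since `toNNReal` truncates at
  -- zero.
  have hQ0 : 0 ≤ ∫ s, ∫ t, ψ s * ψ t * fbmCov H v s t := by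
    have := norm_integral_atom_sq hH hH'.le hv.le hin hψ 0 0
    simp only [Nat.cast_zero, mul_zero, neg_zero, Real.rpow_zero, one_mul] at this
    rw [← this]
    positivity
  have hQ : ∫ s, ∫ t, ψ s * ψ t * fbmCov H v s t = σ ^ 2 := by
    have h1 := (key 0 k₀).2
    rw [← hσX, ← variance_id_map (key 0 k₀).1, h1, variance_id_gaussianReal]
    simp [hQ0]
  refine ⟨(key j k).1, ?_⟩
  rw [(key j k).2, hQ, levelScale, mul_comm]

/-! ### The law of a logged mid-energy -/

lemma image_sq_div_two_Ioi : (fun r : ℝ => r ^ 2 / 2) '' Set.Ioi 0 = Set.Ioi 0 := by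
  ext u
  simp only [Set.mem_image, Set.mem_Ioi]
  constructor
  · rintro ⟨r, hr, rfl⟩
    positivity
  · intro hu
    refine ⟨√(2 * u), by positivity, ?_⟩
    rw [Real.sq_sqrt (by positivity)]
    ring

/-- Half the sum of the squares of two independent centered Gaussian variables of variance `v` is
exponentially distributed with mean `v`. -/
lemma map_half_sum_sq_gaussianReal {v : NNReal} (hv : v ≠ 0) :
    ((gaussianReal 0 v).prod (gaussianReal 0 v)).map (fun p : ℝ × ℝ => (p.1 ^ 2 + p.2 ^ 2) / 2) =
      expMeasure (1 / v : ℝ) := by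
  have hv' : (0 : ℝ) < v := by positivity
  have hg : Measurable fun p : ℝ × ℝ => (p.1 ^ 2 + p.2 ^ 2) / 2 := by fun_prop
  ext s hs
  have hind : Measurable (s.indicator (1 : ℝ → ENNReal)) := measurable_one.indicator hs
  have e1 : ((gaussianReal 0 v).prod (gaussianReal 0 v)).map
      (fun p : ℝ × ℝ => (p.1 ^ 2 + p.2 ^ 2) / 2) s =
      ∫⁻ p : ℝ × ℝ, (gaussianPDF 0 v p.1 * gaussianPDF 0 v p.2) *
        s.indicator 1 ((p.1 ^ 2 + p.2 ^ 2) / 2) := by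
    rw [← lintegral_indicator_one hs, lintegral_map hind hg,
      gaussianReal_of_var_ne_zero _ hv, prod_withDensity (measurable_gaussianPDF _ _)
      (measurable_gaussianPDF _ _)]
    refine (lintegral_withDensity_eq_lintegral_mul _ ?_ (hind.comp hg)).trans ?_
    · exact ((measurable_gaussianPDF 0 v).comp measurable_fst).mul
        ((measurable_gaussianPDF 0 v).comp measurable_snd)
    · rw [Measure.volume_eq_prod]
      rfl
  -- In polar coordinates the integrand depends on the radius only. The factor `(2π)⁻¹` stays
  -- separate, to cancel the length of the angular interval.
  have e2 : ∀ p : ℝ × ℝ, ENNReal.ofReal p.1 • ((gaussianPDF 0 v (polarCoord.symm p).1 *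
        gaussianPDF 0 v (polarCoord.symm p).2) *
        s.indicator 1 (((polarCoord.symm p).1 ^ 2 + (polarCoord.symm p).2 ^ 2) / 2)) =
      ENNReal.ofReal p.1 * (ENNReal.ofReal
        ((2 * Real.pi)⁻¹ * (1 / v * Real.exp (-(1 / v * (p.1 ^ 2 / 2))))) *
        s.indicator 1 (p.1 ^ 2 / 2)) := fun p => by
    have h1 : (polarCoord.symm p).1 ^ 2 + (polarCoord.symm p).2 ^ 2 = p.1 ^ 2 := by
      simp only [polarCoord_symm_apply]
      linear_combination p.1 ^ 2 * Real.cos_sq_add_sin_sq p.2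
    rw [h1, smul_eq_mul]
    congr 2
    rw [gaussianPDF, gaussianPDF, ← ENNReal.ofReal_mul (gaussianPDFReal_nonneg _ _ _)]
    congr 1
    rw [gaussianPDFReal, gaussianPDFReal, mul_mul_mul_comm, ← mul_inv,
      Real.mul_self_sqrt (by positivity), ← Real.exp_add, ← mul_assoc]
    congr 1
    · field_simp
    · congr 1
      rw [← h1]
      field_simp
      ring
  have e3 : expMeasure (1 / v : ℝ) s = ∫⁻ x in Set.Ioi 0,
      exponentialPDF (1 / v : ℝ) x * s.indicator 1 x := by
    have h2 : expMeasure (1 / v : ℝ) s = ∫⁻ x, exponentialPDF (1 / v : ℝ) x * s.indicator 1 x := by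
      rw [← lintegral_indicator_one hs]
      unfold expMeasure gammaMeasure
      rw [lintegral_withDensity_eq_lintegral_mul _ _ hind]
      · rfl
      · exact (measurable_gammaPDFReal 1 _).ennreal_ofReal
    rw [h2, ← lintegral_indicator measurableSet_Ioi]
    refine lintegral_congr_ae ?_
    have h3 : ∀ᵐ x : ℝ, x ≠ 0 := by simp [ae_iff]
    filter_upwards [h3] with x hx
    rcases lt_or_gt_of_ne hx with h | h
    · rw [exponentialPDF_of_neg h, zero_mul,
        Set.indicator_of_notMem (s := Set.Ioi 0) (by simpa using h.le)]
    · rw [Set.indicator_of_mem (s := Set.Ioi 0) (by simpa using h)]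
  rw [e1, ← lintegral_comp_polarCoord_symm]
  simp_rw [e2]
  rw [polarCoord_target, Measure.volume_eq_prod, ← Measure.prod_restrict]
  rw [lintegral_prod]
  swap
  · refine Measurable.aemeasurable ?_
    refine (Measurable.ennreal_ofReal measurable_fst).mul (Measurable.mul ?_ ?_)
    · exact Measurable.ennreal_ofReal (by fun_prop)
    · exact hind.comp (by fun_prop)
  simp only [lintegral_const, Measure.restrict_apply MeasurableSet.univ, Set.univ_inter,
    Real.volume_Ioo]
  -- The substitution `u = r² / 2` absorbs the polar Jacobian `r`.
  have e4 := lintegral_image_eq_lintegral_abs_deriv_mul (measurableSet_Ioi (a := (0 : ℝ)))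
    (f := fun r => r ^ 2 / 2) (f' := fun r => r)
    (fun r _ => by
      have := ((hasDerivAt_id r).pow 2).div_const 2
      refine HasDerivAt.hasDerivWithinAt ?_
      refine this.congr_deriv ?_
      simp)
    (fun a ha b hb hab => by
      have ha' : 0 < a := ha
      have hb' : 0 < b := hb
      have hab' : a ^ 2 / 2 = b ^ 2 / 2 := hab
      exact (pow_left_inj₀ ha'.le hb'.le (by norm_num)).1 (by linarith : a ^ 2 = b ^ 2))
    (fun x => exponentialPDF (1 / v : ℝ) x * s.indicator 1 x)
  rw [image_sq_div_two_Ioi] at e4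
  rw [e3, e4]
  refine setLIntegral_congr_fun measurableSet_Ioi fun r hr => ?_
  have hr' : 0 < r := hr
  have h4 : (0 : ℝ) ≤ r ^ 2 / 2 := by positivity
  simp only [abs_of_pos hr', exponentialPDF_of_nonneg h4]
  rw [show ∀ a b c d : ENNReal, a * (b * c) * d = a * (b * d * c) by intros; ring,
    ← ENNReal.ofReal_mul (by positivity)]
  congr 3
  field_simp
  ring

/-- The law of the logarithm of a standard exponential variable. -/
noncomputable def logExpMeasure : Measure ℝ := (expMeasure 1).map Real.log

instance : IsProbabilityMeasure logExpMeasure :=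
  have := isProbabilityMeasure_expMeasure one_pos
  Measure.isProbabilityMeasure_map Real.measurable_log.aemeasurable

lemma expMeasure_Iic {r : ℝ} (hr : 0 < r) {x : ℝ} (hx : 0 ≤ x) :
    expMeasure r (Set.Iic x) = ENNReal.ofReal (1 - Real.exp (-(r * x))) := by
  have := isProbabilityMeasure_expMeasure hr
  rw [← ofReal_cdf, cdf_expMeasure_eq hr, if_pos hx]

lemma map_log_expMeasure_Iic {r : ℝ} (hr : 0 < r) (t : ℝ) :
    (expMeasure r).map Real.log (Set.Iic t) =
      ENNReal.ofReal (1 - Real.exp (-(r * Real.exp t))) := by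
  rw [Measure.map_apply Real.measurable_log measurableSet_Iic, ← expMeasure_Iic hr
    (Real.exp_pos t).le]
  refine measure_congr ?_
  -- The values of `Real.log` at nonpositive numbers are harmless: this half-line is null.
  have h0 : expMeasure r (Set.Iic 0) = 0 := by simp [expMeasure_Iic hr]
  have h1 : ∀ᵐ x ∂(expMeasure r), 0 < x := by
    rw [ae_iff]
    simpa [Set.Iic] using h0
  filter_upwards [h1] with x hx
  have : (Real.log x ≤ t) = (x ≤ Real.exp t) := propext (Real.log_le_iff_le_exp hx)
  exact this

lemma logExpMeasure_Iic (t : ℝ) :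
    logExpMeasure (Set.Iic t) = ENNReal.ofReal (1 - Real.exp (-Real.exp t)) := by
  rw [logExpMeasure, map_log_expMeasure_Iic one_pos, one_mul]

lemma map_log_expMeasure {v : ℝ} (hv : 0 < v) :
    (expMeasure (1 / v)).map Real.log = logExpMeasure.map (· + Real.log v) := by
  have := isProbabilityMeasure_expMeasure (one_div_pos.2 hv)
  have := Measure.isProbabilityMeasure_map (μ := expMeasure (1 / v))
    Real.measurable_log.aemeasurable
  have := Measure.isProbabilityMeasure_map (μ := logExpMeasure) (f := (· + Real.log v))
    (by fun_prop)
  refine Measure.ext_of_Iic _ _ fun t => ?_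
  rw [map_log_expMeasure_Iic (one_div_pos.2 hv), Measure.map_apply (by fun_prop) measurableSet_Iic]
  have : (fun x => x + Real.log v) ⁻¹' Set.Iic t = Set.Iic (t - Real.log v) := by
    ext x; simp [le_sub_iff_add_le]
  rw [this, logExpMeasure_Iic, Real.exp_sub, Real.exp_log hv]
  congr 4
  ring

lemma map_log_midEnergy {Ω : Type*} [MeasurableSpace Ω] {P : Measure Ω} [IsProbabilityMeasure P]
    {N : ℕ} {d : ℕ → Ω → ℝ} {k : ℕ} {v : ℝ} (hv : 0 < v)
    (hm : AEMeasurable (d k) P) (hm' : AEMeasurable (d (k + N / 2)) P)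
    (h : P.map (d k) = gaussianReal 0 v.toNNReal)
    (h' : P.map (d (k + N / 2)) = gaussianReal 0 v.toNNReal)
    (hind : IndepFun (d k) (d (k + N / 2)) P) :
    P.map (fun ω => Real.log (midEnergy N d k ω)) = logExpMeasure.map (· + Real.log v) := by
  have e1 := (indepFun_iff_map_prod_eq_prod_map_map hm hm').1 hind
  rw [h, h'] at e1
  have e2 := map_half_sum_sq_gaussianReal (v := v.toNNReal) (by simpa using hv)
  rw [← e1, AEMeasurable.map_map_of_aemeasurable (by fun_prop) (hm.prodMk hm'),
    Real.coe_toNNReal _ hv.le] at e2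
  rw [← map_log_expMeasure hv, ← e2, AEMeasurable.map_map_of_aemeasurable (by fun_prop)]
  · rfl
  · exact Measurable.comp_aemeasurable (g := fun p : ℝ × ℝ => (p.1 ^ 2 + p.2 ^ 2) / 2)
      (by fun_prop) (hm.prodMk hm')

/-! ### Order statistics: counting, measurability, translation -/

/-- Sorting permutes the indices and so preserves the number of points below `t`. Truncated
subtraction makes rank 0 behave like rank 1, hence the form `r - 1 <` in place of `r ≤`. -/
lemma orderStat_le_iff {n : ℕ} (x : Fin n → ℝ) {r : ℕ} (hr : r - 1 < n) (t : ℝ) :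
    orderStat x r ≤ t ↔ r - 1 < (Finset.univ.filter fun i => x i ≤ t).card := by
  have h := Tuple.lt_card_le_iff_apply_le_of_monotone (f := x ∘ Tuple.sort x)
    (j := ⟨r - 1, hr⟩) (a := t) (Tuple.monotone_sort x)
  have hc : (Finset.univ.filter fun i => (x ∘ Tuple.sort x) i ≤ t).card =
      (Finset.univ.filter fun i => x i ≤ t).card := by
    refine Finset.card_bij (fun i _ => Tuple.sort x i) (by simp) (by simp) fun b hb => ?_
    exact ⟨(Tuple.sort x).symm b, by simpa using hb, by simp⟩
  rw [hc] at h
  rw [orderStat, dif_pos hr]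
  exact h.symm

lemma measurable_orderStat {n : ℕ} (r : ℕ) : Measurable fun x : Fin n → ℝ => orderStat x r := by
  by_cases hr : r - 1 < n
  · refine measurable_of_Iic fun t => ?_
    have e : (fun x : Fin n → ℝ => orderStat x r) ⁻¹' Set.Iic t =
        {x | r - 1 < ∑ i, if x i ≤ t then 1 else 0} := by
      ext x
      simp only [Set.mem_preimage, Set.mem_Iic, Set.mem_ofPred_eq, orderStat_le_iff x hr,
        Finset.card_filter]
    rw [e]
    refine measurableSet_lt measurable_const (Finset.measurable_sum _ fun i _ => ?_)
    exact Measurable.ite (measurableSet_le (measurable_pi_apply i) measurable_const)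
      measurable_const measurable_const
  · simp only [orderStat, dif_neg hr]
    exact measurable_const

lemma measurable_generalTrimean {n : ℕ} (α p : ℝ) :
    Measurable fun x : Fin n → ℝ => generalTrimean α p x := by
  unfold generalTrimean sampleQuantile
  exact (((measurable_orderStat _).const_mul _).add ((measurable_orderStat _).const_mul _)).add
    ((measurable_orderStat _).const_mul _)

/-- The rank must be in range: otherwise `orderStat` is 0, which does not follow translations. -/
lemma orderStat_add_const {n : ℕ} (x : Fin n → ℝ) (c : ℝ) {r : ℕ} (hr : r - 1 < n) :
    orderStat (fun i => x i + c) r = orderStat x r + c := by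
  refine eq_of_forall_ge_iff fun t => ?_
  rw [orderStat_le_iff _ hr, ← le_sub_iff_add_le, orderStat_le_iff _ hr]
  simp only [le_sub_iff_add_le]

lemma sampleQuantile_add_const {n : ℕ} (hn : 0 < n) (x : Fin n → ℝ) (c : ℝ) {q : ℝ} (hq : q < 1) :
    sampleQuantile (fun i => x i + c) q = sampleQuantile x q + c := by
  refine orderStat_add_const x c ?_
  have hle : ⌊(n : ℝ) * q⌋₊ ≤ n := by
    refine Nat.floor_le_of_le ?_
    have : (0 : ℝ) < n := by exact_mod_cast hn
    nlinarith
  omega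

lemma generalTrimean_add_const {n : ℕ} (hn : 0 < n) {α p : ℝ} (hp : 0 < p) (hp' : p < 1 / 2)
    (x : Fin n → ℝ) (c : ℝ) :
    generalTrimean α p (fun i => x i + c) = generalTrimean α p x + c := by
  unfold generalTrimean
  rw [sampleQuantile_add_const hn x c (by linarith), sampleQuantile_add_const hn x c (by norm_num),
    sampleQuantile_add_const hn x c (by linarith)]
  ring

/-! ### Convergence in probability and Ghosh's lemma -/

/-- Convergence to zero in probability of random variables on varying probability spaces. -/
def TendstoZeroInProb {Ω : ℕ → Type*} [∀ m, MeasurableSpace (Ω m)] (P : ∀ m, Measure (Ω m))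
    (f : ∀ m, Ω m → ℝ) : Prop :=
  ∀ ε : ℝ, 0 < ε → Tendsto (fun m => P m {ω | ε ≤ |f m ω|}) atTop (𝓝 0)

namespace TendstoZeroInProb

variable {Ω : ℕ → Type*} [∀ m, MeasurableSpace (Ω m)] {P : ∀ m, Measure (Ω m)}
  {f g : ∀ m, Ω m → ℝ}

lemma of_tendsto_of_subset (h : ∀ ε : ℝ, 0 < ε → ∃ s : ∀ m, Set (Ω m),
    Tendsto (fun m => P m (s m)) atTop (𝓝 0) ∧
    ∀ᶠ m in atTop, {ω | ε ≤ |f m ω|} ⊆ s m) : TendstoZeroInProb P f := by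
  intro ε hε
  obtain ⟨s, hs, hs'⟩ := h ε hε
  refine tendsto_of_tendsto_of_tendsto_of_le_of_le' tendsto_const_nhds hs
    (Eventually.of_forall fun _ => zero_le) ?_
  filter_upwards [hs'] with m hm using measure_mono hm

lemma add (hf : TendstoZeroInProb P f) (hg : TendstoZeroInProb P g) :
    TendstoZeroInProb P fun m ω => f m ω + g m ω := by
  refine of_tendsto_of_subset fun ε hε =>
    ⟨fun m => {ω | ε / 2 ≤ |f m ω|} ∪ {ω | ε / 2 ≤ |g m ω|}, ?_, ?_⟩
  · have := (hf _ (half_pos hε)).add (hg _ (half_pos hε))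
    rw [add_zero] at this
    exact tendsto_of_tendsto_of_tendsto_of_le_of_le tendsto_const_nhds this
      (fun _ => zero_le) fun m => measure_union_le _ _
  · refine Eventually.of_forall fun m ω hω => ?_
    by_contra hn
    simp only [Set.mem_union, Set.mem_ofPred_eq, not_or, not_le] at hn hω
    linarith [abs_add_le (f m ω) (g m ω)]

lemma mul_bounded (hf : TendstoZeroInProb P f) (c : ℕ → ℝ) {C : ℝ} (hC : 0 < C)
    (hc : ∀ᶠ m in atTop, |c m| ≤ C) : TendstoZeroInProb P fun m ω => c m * f m ω := by
  refine of_tendsto_of_subset fun ε hε => ⟨_, hf (ε / C) (by positivity), ?_⟩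
  filter_upwards [hc] with m hm ω hω
  simp only [Set.mem_ofPred_eq, abs_mul] at hω ⊢
  rw [div_le_iff₀ hC]
  nlinarith [mul_le_mul_of_nonneg_right hm (abs_nonneg (f m ω))]

lemma const_mul (hf : TendstoZeroInProb P f) (c : ℝ) :
    TendstoZeroInProb P fun m ω => c * f m ω :=
  hf.mul_bounded (fun _ => c) (C := |c| + 1) (by positivity)
    (Eventually.of_forall fun _ => by linarith)

lemma zero : TendstoZeroInProb P fun _ _ => 0 := by
  refine of_tendsto_of_subset fun ε hε => ⟨fun _ => ∅, by simp, Eventually.of_forall ?_⟩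
  intro m ω hω
  simp only [Set.mem_ofPred_eq, abs_zero] at hω
  linarith

lemma sum {ι : Type*} {s : Finset ι} {F : ι → ∀ m, Ω m → ℝ}
    (h : ∀ i ∈ s, TendstoZeroInProb P (F i)) :
    TendstoZeroInProb P fun m ω => ∑ i ∈ s, F i m ω := by
  classical
  induction s using Finset.induction_on with
  | empty => simpa using zero
  | insert a s ha ih =>
    simp only [Finset.sum_insert ha]
    exact (h a (by simp)).add (ih fun i hi => h i (by simp [hi]))

end TendstoZeroInProb

/-- **Ghosh's lemma**: if `W` is tight and, for every level, `V` and `W` are asymptotically never on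
clearly different sides of it, then `V - W` tends to zero in probability. -/
lemma tendstoZeroInProb_sub_of_levels {Ω : Type*} [MeasurableSpace Ω] {P : Measure Ω}
    {V W : ℕ → Ω → ℝ}
    (htight : ∀ δ : ENNReal, 0 < δ → ∃ K : ℝ, ∀ᶠ n in atTop, P {ω | K ≤ |W n ω|} ≤ δ)
    (hlevel : ∀ y η : ℝ, 0 < η → Tendsto (fun n => P {ω | (V n ω ≤ y ∧ y + η ≤ W n ω) ∨
      (y < V n ω ∧ W n ω ≤ y - η)}) atTop (𝓝 0)) :
    TendstoZeroInProb (fun _ => P) fun n ω => V n ω - W n ω := by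
  intro ε hε
  rw [ENNReal.tendsto_nhds_zero]
  intro δ hδ
  obtain ⟨K, hK⟩ := htight (δ / 2) (ENNReal.half_pos hδ.ne')
  set η : ℝ := ε / 4 with hη
  have hη0 : 0 < η := by positivity
  -- The levels chosen below are less than `2η` away from `W`, and `|W| < K`; the summand 2 keeps
  -- their indices in the finite grid.
  let L : ℤ := ⌈K / η⌉ + 2
  let B : ℤ → ℕ → Set Ω := fun k n => {ω | (V n ω ≤ k * η ∧ k * η + η ≤ W n ω) ∨
      (k * η < V n ω ∧ W n ω ≤ k * η - η)}
  have hsum : Tendsto (fun n => ∑ k ∈ Finset.Icc (-L) L, P (B k n)) atTop (𝓝 0) := by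
    have := tendsto_finsetSum (Finset.Icc (-L) L) fun k _ => hlevel (k * η) η hη0
    simpa using this
  filter_upwards [hK, (ENNReal.tendsto_nhds_zero.1 hsum) (δ / 2) (ENNReal.half_pos hδ.ne')]
    with n h1 h2
  have hsub : {ω | ε ≤ |V n ω - W n ω|} ⊆ {ω | K ≤ |W n ω|} ∪ ⋃ k ∈ Finset.Icc (-L) L, B k n := by
    intro ω hω
    by_contra hn
    simp only [Set.mem_union, Set.mem_ofPred_eq, Set.mem_iUnion, not_or, not_exists,
      not_le] at hn hω
    obtain ⟨hn1, hn2⟩ := hn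
    obtain ⟨hw1, hw2⟩ := abs_lt.1 hn1
    have hw : W n ω = W n ω / η * η := by field_simp
    have hKL : K / η ≤ L - 2 := by
      have := Int.le_ceil (K / η)
      simp only [L]; push_cast; linarith
    have hu : W n ω / η < K / η := by gcongr
    have hl : -(K / η) < W n ω / η := by rw [← neg_div]; gcongr
    rcases le_abs.1 hω with h | h
    -- Here `V ≥ W + 4η`. The level `(⌈W/η⌉ + 1)η` is at least `W + η` and less than `W + 2η`, so it
    -- separates the two; the other case is its mirror image.
    · have c1 := Int.le_ceil (W n ω / η)
      have c2 := Int.ceil_lt_add_one (W n ω / η)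
      have hmem : ⌈W n ω / η⌉ + 1 ∈ Finset.Icc (-L) L := by
        rw [Finset.mem_Icc]
        constructor
        · have : ((-L : ℤ) : ℝ) ≤ ((⌈W n ω / η⌉ + 1 : ℤ) : ℝ) := by push_cast; linarith
          exact_mod_cast this
        · have : ((⌈W n ω / η⌉ + 1 : ℤ) : ℝ) ≤ (L : ℝ) := by push_cast; linarith
          exact_mod_cast this
      refine hn2 _ hmem (Or.inr ⟨?_, ?_⟩)
      · push_cast
        nlinarith
      · push_cast
        nlinarith
    · have c1 := Int.floor_le (W n ω / η)
      have c2 := Int.lt_floor_add_one (W n ω / η)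
      have hmem : ⌊W n ω / η⌋ - 1 ∈ Finset.Icc (-L) L := by
        rw [Finset.mem_Icc]
        constructor
        · have : ((-L : ℤ) : ℝ) ≤ ((⌊W n ω / η⌋ - 1 : ℤ) : ℝ) := by push_cast; linarith
          exact_mod_cast this
        · have : ((⌊W n ω / η⌋ - 1 : ℤ) : ℝ) ≤ (L : ℝ) := by push_cast; linarith
          exact_mod_cast this
      refine hn2 _ hmem (Or.inl ⟨?_, ?_⟩)
      · push_cast
        nlinarith
      · push_cast
        nlinarith
  calc P {ω | ε ≤ |V n ω - W n ω|} ≤ P {ω | K ≤ |W n ω|} + P (⋃ k ∈ Finset.Icc (-L) L, B k n) :=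
        (measure_mono hsub).trans (measure_union_le _ _)
    _ ≤ δ / 2 + δ / 2 := add_le_add h1 ((measure_biUnion_finset_le _ _).trans h2)
    _ = δ := ENNReal.add_halves δ

/-! ### Bahadur's representation -/

/-- Chebyshev's inequality for sums of bounded functions of an i.i.d. sequence. -/
lemma measure_le_abs_sum_sub {Ω : Type*} [MeasurableSpace Ω] {P : Measure Ω}
    [IsProbabilityMeasure P] {U : ℕ → Ω → ℝ} {ν : Measure ℝ} (hU : ∀ i, Measurable (U i))
    (hlaw : ∀ i, P.map (U i) = ν) (hind : iIndepFun U P) {h : ℝ → ℝ} (hh : Measurable h) {C : ℝ}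
    (hC : ∀ x, |h x| ≤ C) (n : ℕ) {c : ℝ} (hc : 0 < c) :
    P {ω | c ≤ |∑ i ∈ Finset.range n, h (U i ω) - n * ∫ x, h x ∂ν|} ≤
      ENNReal.ofReal (n * (∫ x, h x ^ 2 ∂ν) / c ^ 2) := by
  have hL : ∀ i, MemLp (fun ω => h (U i ω)) 2 P := fun i =>
    MemLp.of_bound (hh.comp (hU i)).aestronglyMeasurable C (ae_of_all _ fun ω => hC _)
  have hLs : MemLp (fun ω => ∑ i ∈ Finset.range n, h (U i ω)) 2 P :=
    memLp_finsetSum _ fun i _ => hL i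
  have hmean : ∫ ω, ∑ i ∈ Finset.range n, h (U i ω) ∂P = n * ∫ x, h x ∂ν := by
    rw [integral_finsetSum _ fun i _ => (hL i).integrable (by norm_num)]
    have : ∀ i, ∫ ω, h (U i ω) ∂P = ∫ x, h x ∂ν := fun i => by
      rw [← hlaw i, integral_map (hU i).aemeasurable hh.aestronglyMeasurable]
    simp [this]
  have hvar : Var[fun ω => ∑ i ∈ Finset.range n, h (U i ω); P] ≤ n * ∫ x, h x ^ 2 ∂ν := by
    have e : (fun ω => ∑ i ∈ Finset.range n, h (U i ω)) =
        ∑ i ∈ Finset.range n, fun ω => h (U i ω) := by ext ω; simp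
    rw [e, IndepFun.variance_sum (fun i _ => hL i)]
    · have : ∀ i, Var[fun ω => h (U i ω); P] ≤ ∫ x, h x ^ 2 ∂ν := fun i => by
        refine (variance_le_expectation_sq (hL i).1).trans (le_of_eq ?_)
        rw [← hlaw i, integral_map (hU i).aemeasurable (hh.pow_const 2).aestronglyMeasurable]
        rfl
      refine (Finset.sum_le_sum fun i _ => this i).trans ?_
      simp
    · intro i _ j _ hij
      exact (hind.indepFun hij).comp hh hh
  have := meas_ge_le_variance_div_sq hLs hc
  rw [hmean] at this
  refine this.trans (ENNReal.ofReal_le_ofReal ?_)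
  gcongr

/-- The number of sample points at most `x`, among the first `n` points of a sequence. -/
noncomputable def countLE (u : ℕ → ℝ) (n : ℕ) (x : ℝ) : ℝ :=
  ∑ i ∈ Finset.range n, (Set.Iic x).indicator (fun _ => (1 : ℝ)) (u i)

lemma countLE_eq_card (u : ℕ → ℝ) (n : ℕ) (x : ℝ) :
    countLE u n x = ((Finset.univ.filter fun r : Fin n => u r ≤ x).card : ℝ) := by
  rw [Finset.card_filter, countLE, ← Fin.sum_univ_eq_sum_range
    (fun i => (Set.Iic x).indicator (fun _ => (1 : ℝ)) (u i))]
  push_cast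
  simp [Set.indicator_apply]

/-- Turns a quantile event into one about a sum of indicators. A rank at least 1 is what allows `r -
1 <` to become `r ≤`. -/
lemma sampleQuantile_le_iff (u : ℕ → ℝ) {n : ℕ} {q : ℝ} (hr : 1 ≤ ⌊(n : ℝ) * q⌋₊) (hq : q < 1)
    (x : ℝ) : sampleQuantile (fun r : Fin n => u r) q ≤ x ↔
      (⌊(n : ℝ) * q⌋₊ : ℝ) ≤ countLE u n x := by
  have hn : 0 < n := by
    rcases Nat.eq_zero_or_pos n with h | h
    · simp [h] at hr
    · exact h
  have hle : ⌊(n : ℝ) * q⌋₊ ≤ n := by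
    refine Nat.floor_le_of_le ?_
    have : (0 : ℝ) < n := by exact_mod_cast hn
    nlinarith
  rw [sampleQuantile, orderStat_le_iff _ (by omega), countLE_eq_card, Nat.cast_le]
  omega

/-- The slope at `s = 0` of `F (ξ + y s)`, taken along `s = n^{-1/2}`; differentiability at the
single point `ξ` is enough. -/
lemma tendsto_sqrt_mul_sub {F : ℝ → ℝ} {ξ f : ℝ} (hF : HasDerivAt F f ξ) (y : ℝ) :
    Tendsto (fun n : ℕ => √(n : ℝ) * (F (ξ + y / √(n : ℝ)) - F ξ)) atTop (𝓝 (f * y)) := by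
  have h1 : HasDerivAt (fun s : ℝ => F (ξ + y * s)) (f * y) 0 := by
    have h2 : HasDerivAt (fun s : ℝ => ξ + y * s) y 0 := by
      simpa using ((hasDerivAt_id (0 : ℝ)).const_mul y).const_add ξ
    exact HasDerivAt.comp (0 : ℝ) (h₂ := F) (by simpa using hF) h2
  rw [hasDerivAt_iff_tendsto_slope_zero] at h1
  have h3 : Tendsto (fun n : ℕ => (√(n : ℝ))⁻¹) atTop (𝓝[≠] 0) := by
    rw [tendsto_nhdsWithin_iff]
    refine ⟨tendsto_inv_atTop_zero.comp (Real.tendsto_sqrt_atTop.comp tendsto_natCast_atTop_atTop),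
      ?_⟩
    filter_upwards [eventually_gt_atTop 0] with n hn
    have : (0 : ℝ) < n := by exact_mod_cast hn
    have : 0 < (√(n : ℝ))⁻¹ := by positivity
    exact this.ne'
  refine (h1.comp h3).congr fun n => ?_
  simp [div_eq_mul_inv]

/-- The half-lines are nested, so the squared difference is the indicator of the interval between
`a` and `b`. -/
lemma integral_indicator_Iic_sub_sq (ν : Measure ℝ) [IsProbabilityMeasure ν] (a b : ℝ) :
    ∫ x, ((Set.Iic a).indicator (fun _ => (1 : ℝ)) x -
      (Set.Iic b).indicator (fun _ => (1 : ℝ)) x) ^ 2 ∂ν = |ν.real (Set.Iic a) - ν.real (Set.Iic b)| := by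
  wlog hab : a ≤ b generalizing a b
  · rw [abs_sub_comm, ← this b a (le_of_not_ge hab)]
    congr 1
    ext x
    ring
  have h1 : ∀ x, ((Set.Iic a).indicator (fun _ => (1 : ℝ)) x -
      (Set.Iic b).indicator (fun _ => (1 : ℝ)) x) ^ 2 =
      (Set.Iic b).indicator (fun _ => (1 : ℝ)) x - (Set.Iic a).indicator (fun _ => (1 : ℝ)) x := by
    intro x
    simp only [Set.indicator_apply, Set.mem_Iic]
    split_ifs <;> first | (norm_num; done) | (exfalso; linarith)
  simp_rw [h1]
  have hi : ∀ c : ℝ, Integrable ((Set.Iic c).indicator (fun _ => (1 : ℝ))) ν := fun c =>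
    (integrable_const 1).indicator measurableSet_Iic
  have hm : ν.real (Set.Iic a) ≤ ν.real (Set.Iic b) := measureReal_mono (Set.Iic_subset_Iic.2 hab)
  rw [integral_sub (hi b) (hi a), integral_indicator_const _ measurableSet_Iic,
    integral_indicator_const _ measurableSet_Iic, abs_sub_comm, abs_of_nonneg (by linarith)]
  simp

/-- The influence function of the `q`-th quantile `ξ`, where `f` is the density at `ξ`. -/
noncomputable def quantileInfluence (q ξ f x : ℝ) : ℝ :=
  (q - (Set.Iic ξ).indicator (fun _ => (1 : ℝ)) x) / f

lemma measurable_quantileInfluence (q ξ f : ℝ) : Measurable (quantileInfluence q ξ f) :=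
  (measurable_const.sub (measurable_const.indicator measurableSet_Iic)).div_const f

lemma abs_quantileInfluence_le {q ξ f : ℝ} (hq : 0 ≤ q) (hq' : q ≤ 1) (hf : 0 < f) (x : ℝ) :
    |quantileInfluence q ξ f x| ≤ 1 / f := by
  rw [quantileInfluence, abs_div, abs_of_pos hf]
  gcongr
  rw [abs_le, Set.indicator_apply]
  split_ifs <;> constructor <;> linarith

lemma sum_quantileInfluence (q ξ f : ℝ) (u : ℕ → ℝ) (n : ℕ) :
    ∑ i ∈ Finset.range n, quantileInfluence q ξ f (u i) = (n * q - countLE u n ξ) / f := by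
  simp only [quantileInfluence]
  rw [← Finset.sum_div, Finset.sum_sub_distrib, countLE]
  simp

lemma integral_quantileInfluence {ν : Measure ℝ} [IsProbabilityMeasure ν] {q ξ : ℝ} (f : ℝ)
    (hq : ν.real (Set.Iic ξ) = q) : ∫ x, quantileInfluence q ξ f x ∂ν = 0 := by
  simp only [quantileInfluence]
  rw [integral_div, integral_sub (integrable_const q)
    ((integrable_const 1).indicator measurableSet_Iic),
    integral_indicator_const _ measurableSet_Iic]
  simp [hq]

/-- **Bahadur's representation** of a sample quantile, in probability. -/
theorem bahadur {Ω : Type*} [MeasurableSpace Ω] {P : Measure Ω}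
    [IsProbabilityMeasure P] {U : ℕ → Ω → ℝ} {ν : Measure ℝ} [IsProbabilityMeasure ν]
    (hU : ∀ i, Measurable (U i)) (hlaw : ∀ i, P.map (U i) = ν) (hind : iIndepFun U P)
    {q ξ f : ℝ} (hq : 0 < q) (hq' : q < 1) (hf : 0 < f) (hξ : ν.real (Set.Iic ξ) = q)
    (hF : HasDerivAt (fun t => ν.real (Set.Iic t)) f ξ) :
    TendstoZeroInProb (fun _ => P) fun n ω =>
      √(n : ℝ) * (sampleQuantile (fun r : Fin n => U r ω) q - ξ) -
      (√(n : ℝ))⁻¹ * ∑ i ∈ Finset.range n, quantileInfluence q ξ f (U i ω) := by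
  have hpos : ∀ᶠ n : ℕ in atTop, 0 < √(n : ℝ) := by
    filter_upwards [eventually_gt_atTop 0] with n hn
    have : (0 : ℝ) < n := by exact_mod_cast hn
    positivity
  refine tendstoZeroInProb_sub_of_levels ?_ ?_
  · intro δ hδ
    -- Tightness: the normalized sum of influences is centered, with second moment bounded by `c`
    -- for every `n`, so Chebyshev gives `c / K²`.
    set c := ∫ x, quantileInfluence q ξ f x ^ 2 ∂ν
    have h1 : Tendsto (fun K : ℝ => ENNReal.ofReal (c / K ^ 2)) atTop (𝓝 0) := by
      rw [← ENNReal.ofReal_zero]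
      exact ENNReal.tendsto_ofReal
        (tendsto_const_nhds.div_atTop (tendsto_pow_atTop (by norm_num)))
    obtain ⟨K, hK1, hK2⟩ := (((ENNReal.tendsto_nhds_zero.1 h1) δ hδ).and
      (eventually_gt_atTop (0 : ℝ))).exists
    refine ⟨K, ?_⟩
    filter_upwards [hpos] with n hn
    have h2 := measure_le_abs_sum_sub hU hlaw hind (measurable_quantileInfluence q ξ f)
      (abs_quantileInfluence_le hq.le hq'.le hf) n (mul_pos hK2 hn)
    rw [integral_quantileInfluence f hξ, mul_zero] at h2
    refine (measure_mono ?_).trans (h2.trans (le_trans (ENNReal.ofReal_le_ofReal ?_) hK1))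
    · intro ω hω
      simp only [Set.mem_ofPred_eq, abs_mul, sub_zero] at hω ⊢
      rw [abs_of_pos (inv_pos.2 hn), inv_mul_eq_div, le_div_iff₀ hn] at hω
      exact hω
    · rw [mul_pow, Real.sq_sqrt (Nat.cast_nonneg n)]
      have : (n : ℝ) ≠ 0 := by
        intro h
        rw [h] at hn
        simp at hn
      refine le_of_eq ?_
      field_simp
      rfl
  · intro y η hη
    set x : ℕ → ℝ := fun n => ξ + y / √(n : ℝ) with hx
    set F : ℝ → ℝ := fun t => ν.real (Set.Iic t) with hFdef
    have hd := tendsto_sqrt_mul_sub hF y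
    -- Replacing the count at `ξ` by the count at the nearby point `x n` costs a sum of `g n`. Its
    -- summands have second moment `|F ξ - F (x n)| / f²`, which tends to zero, so the centered sum
    -- is `o(√n)` in probability.
    let g : ℕ → ℝ → ℝ := fun n u => ((Set.Iic ξ).indicator (fun _ => (1 : ℝ)) u -
      (Set.Iic (x n)).indicator (fun _ => (1 : ℝ)) u) / f
    have hgm : ∀ n, Measurable (g n) := fun n => ((measurable_const.indicator measurableSet_Iic).sub
      (measurable_const.indicator measurableSet_Iic)).div_const f
    have hgb : ∀ n u, |g n u| ≤ 1 / f := fun n u => by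
      simp only [g]
      rw [abs_div, abs_of_pos hf]
      gcongr
      rw [abs_le, Set.indicator_apply, Set.indicator_apply]
      split_ifs <;> constructor <;> norm_num
    have hg1 : ∀ n, ∫ u, g n u ∂ν = (q - F (x n)) / f := fun n => by
      simp only [g]
      rw [integral_div, integral_sub ((integrable_const 1).indicator measurableSet_Iic)
        ((integrable_const 1).indicator measurableSet_Iic),
        integral_indicator_const _ measurableSet_Iic, integral_indicator_const _ measurableSet_Iic]
      simp [hξ, hFdef]
    have hg2 : ∀ n, ∫ u, g n u ^ 2 ∂ν = |F ξ - F (x n)| / f ^ 2 := fun n => by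
      simp only [g, div_pow]
      rw [integral_div, integral_indicator_Iic_sub_sq]
    have hgs : ∀ n ω, ∑ i ∈ Finset.range n, g n (U i ω) =
        (countLE (U · ω) n ξ - countLE (U · ω) n (x n)) / f := fun n ω => by
      simp only [g]
      rw [← Finset.sum_div, Finset.sum_sub_distrib, countLE, countLE]
    have hxlim : Tendsto x atTop (𝓝 ξ) := by
      have : Tendsto (fun n : ℕ => y / √(n : ℝ)) atTop (𝓝 0) :=
        tendsto_const_nhds.div_atTop (Real.tendsto_sqrt_atTop.comp tendsto_natCast_atTop_atTop)
      simpa [hx] using this.const_add ξ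
    have hB : Tendsto (fun n : ℕ => ENNReal.ofReal (4 * |F ξ - F (x n)| / (f ^ 2 * η ^ 2))) atTop
        (𝓝 0) := by
      have h1 : Tendsto (fun n => F (x n)) atTop (𝓝 (F ξ)) :=
        (hF.continuousAt.tendsto).comp hxlim
      have h2 := (((h1.const_sub (F ξ)).abs).const_mul 4).div_const (f ^ 2 * η ^ 2)
      rw [sub_self, abs_zero, mul_zero, zero_div] at h2
      simpa using ENNReal.tendsto_ofReal h2
    -- The deterministic cutoff for the count at `x n`, on the scale of `W`: the derivative
    -- contributes `f y / f = y`, and the rounding of the rank, less than 1, vanishes after division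
    -- by `√n`.
    have hy : Tendsto (fun n : ℕ => (n * F (x n) - ⌊(n : ℝ) * q⌋₊) / (√(n : ℝ) * f)) atTop
        (𝓝 y) := by
      have h1 : Tendsto (fun n : ℕ => ((n : ℝ) * q - ⌊(n : ℝ) * q⌋₊) / √(n : ℝ)) atTop (𝓝 0) := by
        have h2 : Tendsto (fun n : ℕ => 1 / √(n : ℝ)) atTop (𝓝 0) :=
          tendsto_const_nhds.div_atTop (Real.tendsto_sqrt_atTop.comp tendsto_natCast_atTop_atTop)
        refine tendsto_of_tendsto_of_tendsto_of_le_of_le tendsto_const_nhds h2 (fun n => ?_)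
          fun n => ?_
        · have := Nat.floor_le (a := (n : ℝ) * q) (by positivity)
          exact div_nonneg (by linarith) (Real.sqrt_nonneg _)
        · have := Nat.lt_floor_add_one ((n : ℝ) * q)
          refine div_le_div_of_nonneg_right (by linarith) (Real.sqrt_nonneg _)
      have h3 := (hd.add h1).div_const f
      rw [add_zero, mul_div_cancel_left₀ _ hf.ne'] at h3
      refine h3.congr' ?_
      filter_upwards [hpos] with n hn
      have h4 : (n : ℝ) = √(n : ℝ) * √(n : ℝ) := (Real.mul_self_sqrt (Nat.cast_nonneg n)).symm
      have hξ' : F ξ = q := hξ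
      rw [hξ']
      change (√(n : ℝ) * (F (x n) - q) + _) / f = _
      field_simp
      rw [Real.sq_sqrt (Nat.cast_nonneg n)]
      ring
    have hfloor : ∀ᶠ n : ℕ in atTop, 1 ≤ ⌊(n : ℝ) * q⌋₊ := by
      have h1 : Tendsto (fun n : ℕ => (n : ℝ) * q) atTop atTop :=
        tendsto_natCast_atTop_atTop.atTop_mul_const hq
      exact (tendsto_nat_floor_atTop.comp h1).eventually_ge_atTop 1
    refine tendsto_of_tendsto_of_tendsto_of_le_of_le' tendsto_const_nhds hB
      (Eventually.of_forall fun _ => zero_le) ?_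
    filter_upwards [hpos, hfloor, hy.eventually_lt_const (show y < y + η / 2 by linarith),
      hy.eventually_const_lt (show y - η / 2 < y by linarith)] with n hn hn1 hy1 hy2
    have hcheb := measure_le_abs_sum_sub hU hlaw hind (hgm n) (hgb n) n
      (show 0 < η / 2 * √(n : ℝ) by positivity)
    refine (measure_mono ?_).trans (hcheb.trans (ENNReal.ofReal_le_ofReal ?_))
    · intro ω hω
      simp only [Set.mem_ofPred_eq, sum_quantileInfluence, hgs, hg1] at hω ⊢
      set A := countLE (U · ω) n ξ
      set B := countLE (U · ω) n (x n) with hBdef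
      set r : ℝ := (⌊(n : ℝ) * q⌋₊ : ℝ)
      have hV : √(n : ℝ) * (sampleQuantile (fun r : Fin n => U r ω) q - ξ) ≤ y ↔ r ≤ B := by
        rw [hBdef, ← sampleQuantile_le_iff (U · ω) hn1 hq' (x n), mul_comm, ← le_div_iff₀ hn, hx,
          sub_le_iff_le_add']
      have e : (A - B) / f - n * ((q - F (x n)) / f) =
          -((n * q - A) / f) + (n * F (x n) - B) / f := by
        field_simp; ring
      rw [e]
      rw [← not_le, hV, not_le, inv_mul_eq_div, le_div_iff₀ hn, div_le_iff₀ hn] at hω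
      rw [div_lt_iff₀ (by positivity)] at hy1
      rw [lt_div_iff₀ (by positivity)] at hy2
      -- `V` lies on one side of `y` exactly as the count lies on one side of the rank. So the
      -- normalized count is within `η/2` of `y` or on the `V` side, while `W` is `η` away on the
      -- opposite side. The centered sum of `g n` therefore exceeds `η/2 * √n`.
      rcases hω with ⟨h1, h2⟩ | ⟨h1, h2⟩
      · refine le_abs.2 (Or.inr ?_)
        have h3 : (n * F (x n) - B) / f ≤ (y + η / 2) * √(n : ℝ) := by
          rw [div_le_iff₀ hf]
          nlinarith
        nlinarith
      · refine le_abs.2 (Or.inl ?_)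
        have h3 : (y - η / 2) * √(n : ℝ) ≤ (n * F (x n) - B) / f := by
          rw [le_div_iff₀ hf]
          nlinarith
        nlinarith
    · rw [hg2, mul_pow, Real.sq_sqrt (Nat.cast_nonneg n)]
      have : (n : ℝ) ≠ 0 := by
        intro h
        rw [h] at hn
        simp at hn
      refine le_of_eq ?_
      field_simp
      ring

/-! ### Quantiles, centering constant and asymptotic variance -/

/-- The `q`-th quantile of the logarithm of a standard exponential variable. -/
noncomputable def logExpQuantile (q : ℝ) : ℝ := Real.log (-Real.log (1 - q))

/-- The density of the logarithm of a standard exponential variable at its `q`-th quantile. -/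
noncomputable def logExpDensity (q : ℝ) : ℝ := -((1 - q) * Real.log (1 - q))

lemma neg_log_one_sub_pos {q : ℝ} (hq : 0 < q) (hq' : q < 1) : 0 < -Real.log (1 - q) := by
  have := Real.log_neg (show 0 < 1 - q by linarith) (by linarith)
  linarith

lemma logExpDensity_pos {q : ℝ} (hq : 0 < q) (hq' : q < 1) : 0 < logExpDensity q := by
  rw [logExpDensity, ← mul_neg]
  exact mul_pos (by linarith) (neg_log_one_sub_pos hq hq')

lemma logExpMeasure_real_Iic (t : ℝ) :
    logExpMeasure.real (Set.Iic t) = 1 - Real.exp (-Real.exp t) := by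
  rw [measureReal_def, logExpMeasure_Iic, ENNReal.toReal_ofReal]
  have : Real.exp (-Real.exp t) ≤ 1 := Real.exp_le_one_iff.2 (by linarith [Real.exp_pos t])
  linarith

lemma logExpMeasure_real_Iic_quantile {q : ℝ} (hq : 0 < q) (hq' : q < 1) :
    logExpMeasure.real (Set.Iic (logExpQuantile q)) = q := by
  rw [logExpMeasure_real_Iic, logExpQuantile, Real.exp_log (neg_log_one_sub_pos hq hq'), neg_neg,
    Real.exp_log (by linarith)]
  ring

lemma hasDerivAt_logExpMeasure_real_Iic {q : ℝ} (hq : 0 < q) (hq' : q < 1) :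
    HasDerivAt (fun t => logExpMeasure.real (Set.Iic t)) (logExpDensity q) (logExpQuantile q) := by
  simp_rw [logExpMeasure_real_Iic]
  have h := ((Real.hasDerivAt_exp (logExpQuantile q)).neg.exp).const_sub 1
  refine h.congr_deriv ?_
  have e1 : Real.exp (logExpQuantile q) = -Real.log (1 - q) := by
    rw [logExpQuantile, Real.exp_log (neg_log_one_sub_pos hq hq')]
  simp only [Pi.neg_apply, e1, neg_neg, Real.exp_log (show 0 < 1 - q by linarith), logExpDensity]

lemma logExpQuantile_le {q q' : ℝ} (hq : 0 < q) (h : q ≤ q') (hq' : q' < 1) :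
    logExpQuantile q ≤ logExpQuantile q' := by
  refine Real.log_le_log (neg_log_one_sub_pos hq (by linarith)) (neg_le_neg ?_)
  exact Real.log_le_log (by linarith) (by linarith)

lemma cConst_eq {α p : ℝ} (hp : 0 < p) (hp' : p < 1 / 2) :
    cConst α p = α / 2 * logExpQuantile p + (1 - α) * logExpQuantile (1 / 2)
      + α / 2 * logExpQuantile (1 - p) := by
  have h1 := neg_log_one_sub_pos hp (by linarith)
  have h2 := neg_log_one_sub_pos (q := 1 - p) (by linarith) (by linarith)
  rw [sub_sub_cancel] at h2
  unfold cConst logExpQuantile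
  rw [one_div, Real.log_inv, one_div p, Real.log_inv, Real.log_mul h1.ne' h2.ne', sub_sub_cancel,
    show (1 : ℝ) - 1 / 2 = 2⁻¹ by norm_num, Real.log_inv, neg_neg]
  ring

/-- For `ξ ≤ ξ'` the product of the two indicators is the one at `ξ`, so their covariance is `q - q
q'`; the asymmetric form comes from this order. -/
lemma integral_quantileInfluence_mul {ν : Measure ℝ} [IsProbabilityMeasure ν] {q q' ξ ξ' : ℝ}
    (f f' : ℝ) (hq : ν.real (Set.Iic ξ) = q) (hq' : ν.real (Set.Iic ξ') = q') (h : ξ ≤ ξ') :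
    ∫ x, quantileInfluence q ξ f x * quantileInfluence q' ξ' f' x ∂ν = q * (1 - q') / (f * f') := by
  have hi : ∀ (a c : ℝ), Integrable ((Set.Iic a).indicator (fun _ => c)) ν := fun a c =>
    (integrable_const c).indicator measurableSet_Iic
  have e : ∀ x, quantileInfluence q ξ f x * quantileInfluence q' ξ' f' x =
      (q * q' - (Set.Iic ξ').indicator (fun _ => q) x + (Set.Iic ξ).indicator (fun _ => 1 - q') x)
        / (f * f') := fun x => by
    simp only [quantileInfluence]
    rw [div_mul_div_comm]
    congr 1
    simp only [Set.indicator_apply, Set.mem_Iic]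
    split_ifs <;> first | (ring; done) | (exfalso; linarith)
  simp_rw [e]
  rw [integral_div, integral_add (f := fun x => q * q' - (Set.Iic ξ').indicator (fun _ => q) x)
      ((integrable_const _).sub (hi _ _)) (hi _ _),
    integral_sub (integrable_const _) (hi _ _), integral_indicator_const _ measurableSet_Iic,
    integral_indicator_const _ measurableSet_Iic, hq, hq']
  simp only [integral_const, probReal_univ, smul_eq_mul]
  ring

lemma integral_linear_combination_three {ν : Measure ℝ} {a b c : ℝ → ℝ} (ha : Integrable a ν)
    (hb : Integrable b ν) (hc : Integrable c ν) (r s t : ℝ) :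
    ∫ x, r * a x + s * b x + t * c x ∂ν =
      r * ∫ x, a x ∂ν + s * ∫ x, b x ∂ν + t * ∫ x, c x ∂ν := by
  rw [integral_add (f := fun x => r * a x + s * b x) ((ha.const_mul r).add (hb.const_mul s))
    (hc.const_mul t), integral_add (ha.const_mul r) (hb.const_mul s), integral_const_mul,
    integral_const_mul, integral_const_mul]

lemma integral_linear_combination_three_sq {ν : Measure ℝ} {a b c : ℝ → ℝ} (ha : MemLp a 2 ν)
    (hb : MemLp b 2 ν) (hc : MemLp c 2 ν) (r s t : ℝ) :
    ∫ x, (r * a x + s * b x + t * c x) ^ 2 ∂ν =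
      r ^ 2 * ∫ x, a x * a x ∂ν + s ^ 2 * ∫ x, b x * b x ∂ν + t ^ 2 * ∫ x, c x * c x ∂ν +
      (2 * (r * s) * ∫ x, a x * b x ∂ν + 2 * (r * t) * ∫ x, a x * c x ∂ν +
        2 * (s * t) * ∫ x, b x * c x ∂ν) := by
  have haa : Integrable (fun x => a x * a x) ν := ha.integrable_mul ha
  have hbb : Integrable (fun x => b x * b x) ν := hb.integrable_mul hb
  have hcc : Integrable (fun x => c x * c x) ν := hc.integrable_mul hc
  have hab : Integrable (fun x => a x * b x) ν := ha.integrable_mul hb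
  have hac : Integrable (fun x => a x * c x) ν := ha.integrable_mul hc
  have hbc : Integrable (fun x => b x * c x) ν := hb.integrable_mul hc
  rw [← integral_linear_combination_three haa hbb hcc,
    ← integral_linear_combination_three hab hac hbc, ← integral_add
    (f := fun x => r ^ 2 * (a x * a x) + s ^ 2 * (b x * b x) + t ^ 2 * (c x * c x))
    (g := fun x => 2 * (r * s) * (a x * b x) + 2 * (r * t) * (a x * c x) +
      2 * (s * t) * (b x * c x)) (((haa.const_mul _).add (hbb.const_mul _)).add (hcc.const_mul _))
    (((hab.const_mul _).add (hac.const_mul _)).add (hbc.const_mul _))]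
  congr 1
  ext x
  ring

/-- The influence function of the general trimean at the log-exponential law. -/
noncomputable def trimeanInfluence (α p x : ℝ) : ℝ :=
  α / 2 * quantileInfluence p (logExpQuantile p) (logExpDensity p) x
    + (1 - α) * quantileInfluence (1 / 2) (logExpQuantile (1 / 2)) (logExpDensity (1 / 2)) x
    + α / 2 * quantileInfluence (1 - p) (logExpQuantile (1 - p)) (logExpDensity (1 - p)) x

lemma measurable_trimeanInfluence (α p : ℝ) : Measurable (trimeanInfluence α p) :=
  (((measurable_quantileInfluence _ _ _).const_mul _).add
    ((measurable_quantileInfluence _ _ _).const_mul _)).add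
    ((measurable_quantileInfluence _ _ _).const_mul _)

lemma memLp_quantileInfluence {q : ℝ} (hq : 0 < q) (hq' : q < 1) :
    MemLp (quantileInfluence q (logExpQuantile q) (logExpDensity q)) 2 logExpMeasure :=
  MemLp.of_bound (measurable_quantileInfluence _ _ _).aestronglyMeasurable _
    (ae_of_all _ (abs_quantileInfluence_le hq.le hq'.le (logExpDensity_pos hq hq')))

lemma exists_abs_trimeanInfluence_le {α p : ℝ} (hp : 0 < p) (hp' : p < 1 / 2) :
    ∃ C, ∀ x, |trimeanInfluence α p x| ≤ C := by
  refine ⟨|α / 2| * (1 / logExpDensity p) + |1 - α| * (1 / logExpDensity (1 / 2))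
    + |α / 2| * (1 / logExpDensity (1 - p)), fun x => ?_⟩
  have h : ∀ {q : ℝ}, 0 < q → q < 1 →
      |quantileInfluence q (logExpQuantile q) (logExpDensity q) x| ≤ 1 / logExpDensity q :=
    fun hq hq' => abs_quantileInfluence_le hq.le hq'.le (logExpDensity_pos hq hq') x
  rw [trimeanInfluence]
  refine (abs_add_three _ _ _).trans ?_
  rw [abs_mul, abs_mul, abs_mul]
  gcongr
  · exact h hp (by linarith)
  · exact h (by norm_num) (by norm_num)
  · exact h (by linarith) (by linarith)

lemma integral_trimeanInfluence {α p : ℝ} (hp : 0 < p) (hp' : p < 1 / 2) :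
    ∫ x, trimeanInfluence α p x ∂logExpMeasure = 0 := by
  have h1 := (memLp_quantileInfluence hp (by linarith)).integrable one_le_two
  have h2 := (memLp_quantileInfluence (q := 1 / 2) (by norm_num) (by norm_num)).integrable
    one_le_two
  have h3 := (memLp_quantileInfluence (q := 1 - p) (by linarith) (by linarith)).integrable
    one_le_two
  simp only [trimeanInfluence]
  rw [integral_linear_combination_three h1 h2 h3,
    integral_quantileInfluence _ (logExpMeasure_real_Iic_quantile hp (by linarith)),
    integral_quantileInfluence _ (logExpMeasure_real_Iic_quantile (by norm_num) (by norm_num)),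
    integral_quantileInfluence _ (logExpMeasure_real_Iic_quantile (by linarith) (by linarith))]
  ring

/-- The asymptotic variance of the general trimean. -/
lemma integral_trimeanInfluence_sq {α p : ℝ} (hp : 0 < p) (hp' : p < 1 / 2) :
    ∫ x, trimeanInfluence α p x ^ 2 ∂logExpMeasure = fConst α p := by
  have m1 := memLp_quantileInfluence hp (by linarith)
  have m2 := memLp_quantileInfluence (q := 1 / 2) (by norm_num) (by norm_num)
  have m3 := memLp_quantileInfluence (q := 1 - p) (by linarith) (by linarith)
  have F1 := logExpMeasure_real_Iic_quantile hp (by linarith)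
  have F2 := logExpMeasure_real_Iic_quantile (q := 1 / 2) (by norm_num) (by norm_num)
  have F3 := logExpMeasure_real_Iic_quantile (q := 1 - p) (by linarith) (by linarith)
  have l12 := logExpQuantile_le hp hp'.le (by norm_num)
  have l23 := logExpQuantile_le (q := 1 / 2) (q' := 1 - p) (by norm_num) (by linarith) (by linarith)
  simp only [trimeanInfluence]
  rw [integral_linear_combination_three_sq m1 m2 m3]
  -- The entries of the covariance matrix of the three influences, each pair taken with the smaller
  -- quantile first.
  rw [integral_quantileInfluence_mul _ _ F1 F1 le_rfl,
    integral_quantileInfluence_mul _ _ F2 F2 le_rfl,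
    integral_quantileInfluence_mul _ _ F3 F3 le_rfl, integral_quantileInfluence_mul _ _ F1 F2 l12,
    integral_quantileInfluence_mul _ _ F2 F3 l23,
    integral_quantileInfluence_mul _ _ F1 F3 (l12.trans l23)]
  have h1 := (neg_log_one_sub_pos hp (by linarith)).ne'
  have h2 := (neg_log_one_sub_pos (q := 1 - p) (by linarith) (by linarith)).ne'
  have h3 : Real.log 2 ≠ 0 := (Real.log_pos one_lt_two).ne'
  have hp0 : p ≠ 0 := hp.ne'
  have hp1 : 1 - p ≠ 0 := by linarith
  rw [sub_sub_cancel, neg_ne_zero] at h2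
  rw [neg_ne_zero] at h1
  simp only [fConst, g₁, g₂, logExpDensity, sub_sub_cancel,
    show (1 : ℝ) - 1 / 2 = 1 / 2 by norm_num,
    show Real.log (1 / 2) = -Real.log 2 by rw [one_div, Real.log_inv]]
  field_simp
  ring

lemma fConst_pos {α p : ℝ} (hα : 0 ≤ α) (hα' : α ≤ 1) (hp : 0 < p) (hp' : p < 1 / 2) :
    0 < fConst α p := by
  have h1 : Real.log (1 - p) < 0 := Real.log_neg (by linarith) (by linarith)
  have h2 : Real.log p < 0 := Real.log_neg hp (by linarith)
  have h3 : Real.log (1 / 2) < 0 := Real.log_neg (by norm_num) (by norm_num)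
  have h4 : 0 < Real.log 2 := Real.log_pos one_lt_two
  have h5 : 0 < 1 - p := by linarith
  have m12 := mul_pos_of_neg_of_neg h1 h2
  have m13 := mul_pos_of_neg_of_neg h1 h3
  have m32 := mul_pos_of_neg_of_neg h3 h2
  have hg1 : 0 < g₁ p := by
    have e1 : 0 < Real.log (1 - p) ^ 2 := by rw [sq]; exact mul_pos_of_neg_of_neg h1 h1
    have e2 : 0 < Real.log p ^ 2 := by rw [sq]; exact mul_pos_of_neg_of_neg h2 h2
    unfold g₁
    rw [mul_assoc (1 - p)]
    positivity
  have hg2 : 0 < g₂ p := by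
    unfold g₂
    rw [mul_assoc (1 - p)]
    exact add_pos (div_pos (by positivity) (mul_pos h5 m13)) (div_pos two_pos m32)
  unfold fConst
  have hα2 : 0 ≤ 1 - α := by linarith
  -- One summand must be strictly positive: the median term if `α = 0`, the `g₁` term if `α > 0`,
  -- where `1 - α` may vanish.
  rcases hα.eq_or_lt with h | h
  · rw [← h]
    simp only [sub_zero, zero_mul, zero_div, one_pow, ne_eq, OfNat.ofNat_ne_zero,
      not_false_eq_true, zero_pow, zero_add]
    positivity
  · positivity

/-! ### Limit theorems for an i.i.d. log-exponential sequence -/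

section Iid

variable {Ω : Type*} [MeasurableSpace Ω] {P : Measure Ω} [IsProbabilityMeasure P]
  {U : ℕ → Ω → ℝ} {α p : ℝ}

/-- Bahadur's representation is linear in the quantile, so the three representations combine with
the trimean weights without any joint analysis. -/
lemma generalTrimean_sub_tendstoZeroInProb (hU : ∀ i, Measurable (U i))
    (hlaw : ∀ i, P.map (U i) = logExpMeasure) (hind : iIndepFun U P)
    (hp : 0 < p) (hp' : p < 1 / 2) :
    TendstoZeroInProb (fun _ => P) fun n ω =>
      √(n : ℝ) * (generalTrimean α p (fun r : Fin n => U r ω) - cConst α p) -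
      (√(n : ℝ))⁻¹ * ∑ i ∈ Finset.range n, trimeanInfluence α p (U i ω) := by
  have hB : ∀ {q : ℝ}, 0 < q → q < 1 → TendstoZeroInProb (fun _ => P) fun n ω =>
      √(n : ℝ) * (sampleQuantile (fun r : Fin n => U r ω) q - logExpQuantile q) -
      (√(n : ℝ))⁻¹ * ∑ i ∈ Finset.range n,
        quantileInfluence q (logExpQuantile q) (logExpDensity q) (U i ω) := fun hq hq' =>
    bahadur hU hlaw hind hq hq' (logExpDensity_pos hq hq') (logExpMeasure_real_Iic_quantile hq hq')
      (hasDerivAt_logExpMeasure_real_Iic hq hq')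
  have h := (((hB hp (by linarith)).const_mul (α / 2)).add ((hB (q := 1 / 2) (by norm_num)
    (by norm_num)).const_mul (1 - α))).add ((hB (q := 1 - p) (by linarith)
    (by linarith)).const_mul (α / 2))
  convert h using 3 with n ω
  rw [cConst_eq hp hp', generalTrimean]
  simp only [trimeanInfluence, Finset.sum_add_distrib, ← Finset.mul_sum]
  ring

/-- Asymptotic normality of the general trimean of an i.i.d. log-exponential sequence. -/
theorem generalTrimean_tendstoInDistribution (hU : ∀ i, Measurable (U i))
    (hlaw : ∀ i, P.map (U i) = logExpMeasure) (hind : iIndepFun U P)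
    (hp : 0 < p) (hp' : p < 1 / 2) :
    TendstoInDistribution (fun (n : ℕ) ω =>
      √(n : ℝ) * (generalTrimean α p (fun r : Fin n => U r ω) - cConst α p))
      atTop (id : ℝ → ℝ) (fun _ => P) (gaussianReal 0 (fConst α p).toNNReal) := by
  set X : ℕ → Ω → ℝ := fun i ω => trimeanInfluence α p (U i ω) with hX
  have hg := measurable_trimeanInfluence α p
  have hXm : ∀ i, Measurable (X i) := fun i => hg.comp (hU i)
  obtain ⟨C, hC⟩ := exists_abs_trimeanInfluence_le (α := α) hp hp'
  have hL : MemLp (X 0) 2 P :=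
    MemLp.of_bound (hXm 0).aestronglyMeasurable C (ae_of_all _ fun ω => hC _)
  have hmean : P[X 0] = 0 := by
    rw [← integral_trimeanInfluence (α := α) hp hp', ← hlaw 0,
      integral_map (hU 0).aemeasurable hg.aestronglyMeasurable]
  have hvar : Var[X 0; P] = fConst α p := by
    rw [variance_of_integral_eq_zero (hXm 0).aemeasurable hmean,
      ← integral_trimeanInfluence_sq (α := α) hp hp', ← hlaw 0,
      integral_map (hU 0).aemeasurable (hg.pow_const 2).aestronglyMeasurable]
  have hY : HasLaw (id : ℝ → ℝ) (gaussianReal 0 Var[X 0; P].toNNReal)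
      (gaussianReal 0 (fConst α p).toNNReal) := by
    rw [hvar]
    exact HasLaw.id
  have hid : ∀ i, IdentDistrib (X i) (X 0) P P := fun i =>
    (IdentDistrib.mk (hU i).aemeasurable (hU 0).aemeasurable
      (by rw [hlaw, hlaw])).comp hg
  have hclt := tendstoInDistribution_inv_sqrt_mul_sum_sub hY hL
    (hind.comp (fun _ => trimeanInfluence α p) fun _ => hg) hid
  rw [hmean] at hclt
  simp only [mul_zero, sub_zero] at hclt
  -- Slutsky: an error tending to zero in probability leaves the limit law unchanged.
  refine tendstoInDistribution_of_tendstoInMeasure_sub _ _ hclt ?_ fun n => ?_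
  · rw [tendstoInMeasure_iff_norm]
    intro ε hε
    simpa [hX] using generalTrimean_sub_tendstoZeroInProb (α := α) hU hlaw hind hp hp' ε hε
  · refine Measurable.aemeasurable ?_
    exact (((measurable_generalTrimean α p).comp
      (measurable_pi_lambda _ fun r : Fin n => hU r)).sub_const _).const_mul _

/-- Consistency of the general trimean of an i.i.d. log-exponential sequence. -/
theorem generalTrimean_consistent (hU : ∀ i, Measurable (U i))
    (hlaw : ∀ i, P.map (U i) = logExpMeasure) (hind : iIndepFun U P)
    (hp : 0 < p) (hp' : p < 1 / 2) :
    TendstoZeroInProb (fun _ => P) fun (n : ℕ) ω =>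
      generalTrimean α p (fun r : Fin n => U r ω) - cConst α p := by
  obtain ⟨C, hC⟩ := exists_abs_trimeanInfluence_le (α := α) hp hp'
  have h1 : TendstoZeroInProb (fun _ => P) fun (n : ℕ) ω =>
      (n : ℝ)⁻¹ * ∑ i ∈ Finset.range n, trimeanInfluence α p (U i ω) := by
    intro ε hε
    have hlim : Tendsto (fun n : ℕ => ENNReal.ofReal (fConst α p / (n * ε ^ 2))) atTop (𝓝 0) := by
      rw [← ENNReal.ofReal_zero]
      exact ENNReal.tendsto_ofReal (tendsto_const_nhds.div_atTop
        (tendsto_natCast_atTop_atTop.atTop_mul_const (by positivity)))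
    refine tendsto_of_tendsto_of_tendsto_of_le_of_le' tendsto_const_nhds hlim
      (Eventually.of_forall fun _ => zero_le) ?_
    filter_upwards [eventually_gt_atTop 0] with n hn
    have hn' : (0 : ℝ) < n := by exact_mod_cast hn
    have h2 := measure_le_abs_sum_sub hU hlaw hind (measurable_trimeanInfluence α p) hC n
      (mul_pos hε hn')
    rw [integral_trimeanInfluence hp hp', integral_trimeanInfluence_sq hp hp', mul_zero] at h2
    refine (measure_mono ?_).trans (h2.trans (ENNReal.ofReal_le_ofReal (le_of_eq ?_)))
    · intro ω hω
      simp only [Set.mem_ofPred_eq, abs_mul, sub_zero] at hω ⊢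
      rwa [abs_of_pos (inv_pos.2 hn'), inv_mul_eq_div, le_div_iff₀ hn'] at hω
    · field_simp
  have h2 := (generalTrimean_sub_tendstoZeroInProb (α := α) hU hlaw hind hp hp').mul_bounded
    (fun n : ℕ => (√(n : ℝ))⁻¹) one_pos (by
      filter_upwards [eventually_gt_atTop 0] with n hn
      have hn' : (1 : ℝ) ≤ n := by exact_mod_cast hn
      rw [abs_of_nonneg (by positivity)]
      exact inv_le_one_of_one_le₀ (Real.one_le_sqrt.2 hn'))
  refine TendstoZeroInProb.of_tendsto_of_subset fun ε hε => ⟨_, (h2.add h1) ε hε, ?_⟩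
  filter_upwards [eventually_gt_atTop 0] with n hn ω hω
  simp only [Set.mem_ofPred_eq] at hω ⊢
  have hn' : (0 : ℝ) < n := by exact_mod_cast hn
  have hs : 0 < √(n : ℝ) := by positivity
  have e : (√(n : ℝ))⁻¹ * (√(n : ℝ) * (generalTrimean α p (fun r : Fin n => U r ω) - cConst α p) -
      (√(n : ℝ))⁻¹ * ∑ i ∈ Finset.range n, trimeanInfluence α p (U i ω)) +
      (n : ℝ)⁻¹ * ∑ i ∈ Finset.range n, trimeanInfluence α p (U i ω) =
      generalTrimean α p (fun r : Fin n => U r ω) - cConst α p := by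
    rw [mul_sub, inv_mul_cancel_left₀ hs.ne', ← mul_assoc, ← mul_inv,
      Real.mul_self_sqrt hn'.le]
    ring
  rwa [e]

end Iid

/-! ### Transfer to samples on varying probability spaces -/

section Transfer

variable {Ω : ℕ → Type*} [∀ m, MeasurableSpace (Ω m)] {P : ∀ m, Measure (Ω m)}
  [∀ m, IsProbabilityMeasure (P m)] {n : ℕ → ℕ} {S : ∀ m, Fin (n m) → Ω m → ℝ} {c α p : ℝ}

/-- A finite independent sample has the law of an initial segment of an i.i.d. sequence. -/
lemma identDistrib_sample {Ω Ω' : Type*} [MeasurableSpace Ω] [MeasurableSpace Ω'] {P : Measure Ω}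
    {Q : Measure Ω'} [IsProbabilityMeasure P] [IsProbabilityMeasure Q] {n : ℕ}
    {S : Fin n → Ω → ℝ} {U : ℕ → Ω' → ℝ} {ν : Measure ℝ} (hS : ∀ r, AEMeasurable (S r) P)
    (hlawS : ∀ r, P.map (S r) = ν.map (· + c)) (hindS : iIndepFun S P)
    (hU : ∀ i, Measurable (U i)) (hlaw : ∀ i, Q.map (U i) = ν) (hind : iIndepFun U Q) :
    IdentDistrib (fun ω r => S r ω) (fun ω (r : Fin n) => U r ω + c) P Q := by
  have hUc : ∀ r : Fin n, AEMeasurable (fun ω => U r ω + c) Q := fun r =>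
    ((hU r).add_const c).aemeasurable
  have hindU : iIndepFun (fun (r : Fin n) ω => U r ω + c) Q :=
    (hind.precomp (g := fun r : Fin n => (r : ℕ)) Fin.val_injective).comp (fun _ x => x + c)
      fun _ => by fun_prop
  refine ⟨aemeasurable_pi_lambda _ hS, aemeasurable_pi_lambda _ hUc, ?_⟩
  rw [(iIndepFun_iff_map_fun_eq_pi_map hS).1 hindS, (iIndepFun_iff_map_fun_eq_pi_map hUc).1 hindU]
  congr 1
  ext1 r
  rw [hlawS, ← hlaw r, Measure.map_map (by fun_prop) (hU r)]
  rfl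

/-- Asymptotic normality of the general trimean of independent log-exponential samples. -/
theorem generalTrimean_array_tendstoInDistribution (hn : Tendsto n atTop atTop)
    (hS : ∀ m r, AEMeasurable (S m r) (P m))
    (hlaw : ∀ m r, (P m).map (S m r) = logExpMeasure.map (· + c))
    (hind : ∀ m, iIndepFun (S m) (P m)) (hp : 0 < p) (hp' : p < 1 / 2) :
    TendstoInDistribution (fun m ω =>
      √(n m : ℝ) * (generalTrimean α p (fun r => S m r ω) - (cConst α p + c)))
      atTop (id : ℝ → ℝ) P (gaussianReal 0 (fConst α p).toNNReal) := by
  -- Only the law of each row matters, so row `m` is replaced by the first `n m` terms of one i.i.d.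
  -- sequence, and the limit is taken along `n`.
  obtain ⟨Ω', _, Q, U, hU, hlawU, hindU, _⟩ := exists_iid ℕ logExpMeasure
  have hlim := generalTrimean_tendstoInDistribution (α := α) hU (fun i => (hlawU i).map_eq) hindU
    hp hp'
  have hid : ∀ m, IdentDistrib (fun ω =>
      √(n m : ℝ) * (generalTrimean α p (fun r => S m r ω) - (cConst α p + c)))
      (fun ω => √(n m : ℝ) * (generalTrimean α p (fun r : Fin (n m) => U r ω) - cConst α p))
      (P m) Q := fun m => by
    have h := (identDistrib_sample (hS m) (hlaw m) (hind m) hU (fun i => (hlawU i).map_eq)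
      hindU).comp (u := fun x : Fin (n m) → ℝ =>
        √(n m : ℝ) * (generalTrimean α p x - (cConst α p + c)))
        (((measurable_generalTrimean α p).sub_const _).const_mul _)
    refine h.trans (IdentDistrib.of_ae_eq h.aemeasurable_snd (ae_of_all _ fun ω => ?_))
    simp only [Function.comp_apply]
    rcases Nat.eq_zero_or_pos (n m) with h0 | h0
    -- For an empty sample translation fails, but the factor `√0` makes both sides zero.
    · simp [h0]
    · rw [generalTrimean_add_const h0 hp hp' (fun r : Fin (n m) => U r ω)]
      ring
  refine ⟨fun m => (hid m).aemeasurable_fst, aemeasurable_id, ?_⟩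
  refine (hlim.tendsto.comp hn).congr fun m => ?_
  exact Subtype.ext (hid m).map_eq.symm

/-- Consistency of the general trimean of independent log-exponential samples. -/
theorem generalTrimean_array_consistent (hn : Tendsto n atTop atTop)
    (hS : ∀ m r, AEMeasurable (S m r) (P m))
    (hlaw : ∀ m r, (P m).map (S m r) = logExpMeasure.map (· + c))
    (hind : ∀ m, iIndepFun (S m) (P m)) (hp : 0 < p) (hp' : p < 1 / 2) :
    TendstoZeroInProb P fun m ω => generalTrimean α p (fun r => S m r ω) - (cConst α p + c) := by
  obtain ⟨Ω', _, Q, U, hU, hlawU, hindU, _⟩ := exists_iid ℕ logExpMeasure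
  intro ε hε
  have hlim := (generalTrimean_consistent (α := α) hU (fun i => (hlawU i).map_eq) hindU hp hp'
    ε hε).comp hn
  refine hlim.congr' ?_
  filter_upwards [hn.eventually_gt_atTop 0] with m h0
  have h := (identDistrib_sample (hS m) (hlaw m) (hind m) hU (fun i => (hlawU i).map_eq)
    hindU).measure_mem_eq (s := {x | ε ≤ |generalTrimean α p x - (cConst α p + c)|})
    (measurableSet_le measurable_const
      (((measurable_generalTrimean α p).sub_const _).abs))
  refine Eq.trans ?_ h.symm
  simp only [Function.comp_apply]
  congr 1
  ext ω
  simp only [Set.mem_ofPred_eq, Set.mem_preimage]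
  rw [generalTrimean_add_const h0 hp hp' (fun r : Fin (n m) => U r ω)]
  congr! 2
  ring

end Transfer

/-! ### Regression on the levels -/

lemma levelScale_pos {H σ : ℝ} (hσ : 0 < σ) (j : ℕ) : 0 < levelScale H σ j := by
  unfold levelScale
  positivity

lemma log_levelScale {H σ : ℝ} (hσ : 0 < σ) (j : ℕ) :
    Real.log (levelScale H σ j) = Real.log (σ ^ 2) + -((2 * H + 1) * Real.log 2) * j := by
  rw [levelScale, Real.log_mul (by positivity) (by positivity), Real.log_rpow (by norm_num)]
  ring

lemma sum_sub_mean_eq_zero {S : Finset ℕ} (hS : S.Nonempty) (y : ℕ → ℝ) :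
    ∑ j ∈ S, (y j - (∑ l ∈ S, y l) / S.card) = 0 := by
  have : (S.card : ℝ) ≠ 0 := by exact_mod_cast hS.card_ne_zero
  rw [Finset.sum_sub_distrib, Finset.sum_const, nsmul_eq_mul]
  field_simp
  ring

/-- The least squares slope is a linear combination of the ordinates. -/
lemma olsSlope_eq_sum {S : Finset ℕ} (hS : S.Nonempty) (y : ℕ → ℝ) :
    olsSlope S y = ∑ j ∈ S, (((j : ℝ) - (∑ l ∈ S, (l : ℝ)) / S.card) /
      ∑ j ∈ S, ((j : ℝ) - (∑ l ∈ S, (l : ℝ)) / S.card) ^ 2) * y j := by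
  unfold olsSlope
  -- The centered abscissas sum to zero, so subtracting the mean ordinate has no effect.
  simp_rw [mul_sub, div_mul_eq_mul_div]
  rw [Finset.sum_sub_distrib, ← Finset.sum_mul, sum_sub_mean_eq_zero hS (fun j => (j : ℝ)),
    zero_mul, sub_zero, Finset.sum_div]

lemma olsSlope_affine {S : Finset ℕ} (hS : 2 ≤ S.card) (a b : ℝ) :
    olsSlope S (fun j => a + b * j) = b := by
  have hne : S.Nonempty := Finset.card_pos.1 (by omega)
  have hc : (S.card : ℝ) ≠ 0 := by exact_mod_cast hne.card_ne_zero
  have hmean : ∀ j : ℕ, a + b * (j : ℝ) - (∑ l ∈ S, (a + b * (l : ℝ))) / S.card =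
      b * ((j : ℝ) - (∑ l ∈ S, (l : ℝ)) / S.card) := fun j => by
    rw [Finset.sum_add_distrib, ← Finset.mul_sum, Finset.sum_const, nsmul_eq_mul]
    field_simp
    ring
  -- A vanishing sum would put every level at the mean, impossible for two distinct levels.
  have hpos : ∑ j ∈ S, ((j : ℝ) - (∑ l ∈ S, (l : ℝ)) / S.card) ^ 2 ≠ 0 := by
    intro h0
    rw [Finset.sum_eq_zero_iff_of_nonneg fun _ _ => sq_nonneg _] at h0
    obtain ⟨i, hi, k, hk, hik⟩ := Finset.one_lt_card.1 (show 1 < S.card by omega)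
    have h1 := pow_eq_zero_iff (two_ne_zero) |>.1 (h0 i hi)
    have h2 := pow_eq_zero_iff (two_ne_zero) |>.1 (h0 k hk)
    exact hik (by exact_mod_cast (show (i : ℝ) = k by linarith))
  unfold olsSlope
  simp_rw [hmean]
  rw [div_eq_iff hpos, Finset.mul_sum]
  exact Finset.sum_congr rfl fun j _ => by ring

lemma hurstEstimator_eq {Ω : Type*} (α p : ℝ) (S : Finset ℕ) (N : ℕ) {M : ℕ} (hM : 1 ≤ M)
    (d : ℕ → ℕ → Ω → ℝ) (ω : Ω) : hurstEstimator α p S N M d ω =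
      -(meanSlope α p S N M d ω) / (2 * Real.log 2) - 1 / 2 := by
  have hM' : (M : ℝ) ≠ 0 := by exact_mod_cast (show M ≠ 0 by omega)
  have hl : Real.log 2 ≠ 0 := (Real.log_pos one_lt_two).ne'
  unfold hurstEstimator meanSlope
  rw [Finset.sum_sub_distrib, ← Finset.sum_div, Finset.sum_neg_distrib]
  simp only [Finset.sum_const, Nat.card_Icc, nsmul_eq_mul, add_tsub_cancel_right]
  field_simp

/-- The estimation error of the Hurst exponent is linear in the errors of the trimeans. -/
lemma hurstEstimator_sub_eq {Ω : Type*} {α p σ H : ℝ} (hσ : 0 < σ) {S : Finset ℕ} (hS : 2 ≤ S.card)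
    (N : ℕ) {M : ℕ} (hM : 1 ≤ M) (d : ℕ → ℕ → Ω → ℝ) (ω : Ω) :
    hurstEstimator α p S N M d ω - H = ∑ i ∈ Finset.Icc 1 M,
      -(1 / (M * (2 * Real.log 2))) * ∑ j ∈ S, (((j : ℝ) - (∑ l ∈ S, (l : ℝ)) / S.card) /
      ∑ j ∈ S, ((j : ℝ) - (∑ l ∈ S, (l : ℝ)) / S.card) ^ 2) *
      (logTrimean α p N M (d j) i ω - (cConst α p + Real.log (levelScale H σ j))) := by
  have hM' : (M : ℝ) ≠ 0 := by exact_mod_cast (show M ≠ 0 by omega)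
  have hl : Real.log 2 ≠ 0 := (Real.log_pos one_lt_two).ne'
  have hne : S.Nonempty := Finset.card_pos.1 (by omega)
  have hslope : ∀ i, ∑ j ∈ S, (((j : ℝ) - (∑ l ∈ S, (l : ℝ)) / S.card) /
      ∑ j ∈ S, ((j : ℝ) - (∑ l ∈ S, (l : ℝ)) / S.card) ^ 2) *
      (logTrimean α p N M (d j) i ω - (cConst α p + Real.log (levelScale H σ j))) =
      groupSlope α p S N M d i ω + (2 * H + 1) * Real.log 2 := fun i => by
    simp_rw [mul_sub]
    rw [Finset.sum_sub_distrib, ← olsSlope_eq_sum hne, ← olsSlope_eq_sum hne]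
    -- The target is affine in `j`: `c` and `log σ²` drop out of its slope, leaving `-(2H+1) log 2`.
    simp_rw [log_levelScale hσ, ← add_assoc]
    rw [olsSlope_affine hS, groupSlope]
    ring
  simp_rw [hslope]
  rw [hurstEstimator_eq α p S N hM, meanSlope, ← Finset.mul_sum, Finset.sum_add_distrib]
  simp only [Finset.sum_const, Nat.card_Icc, nsmul_eq_mul, add_tsub_cancel_right]
  field_simp
  ring

end GTLME

/-! ### The main theorem -/

theorem theorem2
    -- fractional Brownian motion, a wavelet, and the level-zero variance
    {Ω' : Type*} [MeasurableSpace Ω'] (P' : Measure Ω') [IsProbabilityMeasure P']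
    (H v : ℝ) (hH : 0 < H) (hH' : H < 1) (hv : 0 < v)
    (X : ℝ → Ω' → ℝ) (hX : IsFractionalBrownianMotion H v X P')
    (ψ : ℝ → ℝ) (hψ : IsMotherWavelet ψ)
    (σ : ℝ) (hσ : 0 < σ) (k₀ : ℕ) (hσX : Var[ndwtCoeff ψ X 0 k₀; P'] = σ ^ 2)
    -- parameters of the trimean, number of levels, number of groups, sample sizes
    (α p : ℝ) (hα : 0 ≤ α) (hα' : α ≤ 1) (hp : 0 < p) (hp' : p < 1 / 2)
    (J M : ℕ) (hM : 1 ≤ M)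
    (N : ℕ → ℕ) (hN : ∀ m, 2 * M ∣ N m) (hN' : Tendsto N atTop atTop)
    -- for each `m`, the coefficients `d m j k` of level `j` and location `k` for size `N m`
    {Ω : ℕ → Type*} [∀ m, MeasurableSpace (Ω m)] (P : (m : ℕ) → Measure (Ω m))
    [∀ m, IsProbabilityMeasure (P m)]
    (d : (m : ℕ) → ℕ → ℕ → Ω m → ℝ)
    (hlaw : ∀ m, ∀ j ∈ Finset.Icc 1 J, ∀ k ∈ Finset.Icc 1 (N m),
      IdentDistrib (d m j k) (ndwtCoeff ψ X j k) (P m) P')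
    (hpair : ∀ m, ∀ j ∈ Finset.Icc 1 J, ∀ k ∈ Finset.Icc 1 (N m / 2),
      IndepFun (d m j k) (d m j (k + N m / 2)) (P m))
    (hgroup : ∀ m, ∀ j ∈ Finset.Icc 1 J, ∀ i ∈ Finset.Icc 1 M,
      iIndepFun (groupEnergy (N m) M (d m j) i) (P m)) :
    -- asymptotic normality with mean `c + log λ_j` and variance `(2M/N) f > 0`
    (0 < fConst α p ∧
      ∀ j ∈ Finset.Icc 1 J, ∀ i ∈ Finset.Icc 1 M,
        TendstoInDistribution
          (fun (m : ℕ) (ω : Ω m) => √((N m : ℝ) / (2 * M)) *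
            (logTrimean α p (N m) M (d m j) i ω
              - (cConst α p + Real.log (levelScale H σ j))))
          atTop (id : ℝ → ℝ) P (gaussianReal 0 (fConst α p).toNNReal)) ∧
    -- the estimator of the Hurst exponent: its formula and its consistency
    (∀ S ⊆ Finset.Icc 1 J, 2 ≤ S.card →
      (∀ m ω, hurstEstimator α p S (N m) M (d m) ω
        = -(meanSlope α p S (N m) M (d m) ω) / (2 * Real.log 2) - 1 / 2) ∧
      ∀ ε : ℝ, 0 < ε → Tendsto
        (fun m => P m {ω | ε ≤ |hurstEstimator α p S (N m) M (d m) ω - H|}) atTop (𝓝 0)) := by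
  have hM0 : 0 < M := hM
  have hn : Tendsto (fun m => N m / 2 / M) atTop atTop := by
    simp_rw [Nat.div_div_eq_div_mul]
    exact (Nat.tendsto_div_const_atTop (by positivity)).comp hN'
  -- Divisibility by `2 * M` makes the natural-number division exact, so the normalization is the
  -- true sample size.
  have hcast : ∀ m, (N m : ℝ) / (2 * M) = ((N m / 2 / M : ℕ) : ℝ) := fun m => by
    rw [Nat.div_div_eq_div_mul, Nat.cast_div (hN m)]
    · push_cast
      rfl
    · push_cast
      positivity
  have hd : ∀ m, ∀ j ∈ Finset.Icc 1 J, ∀ k ∈ Finset.Icc 1 (N m),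
      AEMeasurable (d m j k) (P m) ∧
      (P m).map (d m j k) = gaussianReal 0 (levelScale H σ j).toNNReal := fun m j hj k hk =>
    ⟨(hlaw m j hj k hk).aemeasurable_fst, by
      rw [(hlaw m j hj k hk).map_eq, (map_ndwtCoeff hH hH' hv hX hψ hσX j k).2]⟩
  have hk : ∀ m, ∀ i ∈ Finset.Icc 1 M, ∀ r : Fin (N m / 2 / M),
      i + M * r ∈ Finset.Icc 1 (N m / 2) := fun m i hi r => by
    rw [Finset.mem_Icc] at hi ⊢
    have h1 : M * (r + 1) ≤ N m / 2 :=
      (Nat.mul_le_mul_left M r.2).trans (Nat.mul_div_le (N m / 2) M)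
    rw [mul_add, mul_one] at h1
    omega
  have hk1 : ∀ m, ∀ k ∈ Finset.Icc 1 (N m / 2), k ∈ Finset.Icc 1 (N m) := fun m k hk => by
    rw [Finset.mem_Icc] at hk ⊢
    omega
  have hk2 : ∀ m, ∀ k ∈ Finset.Icc 1 (N m / 2), k + N m / 2 ∈ Finset.Icc 1 (N m) :=
    fun m k hk => by
      rw [Finset.mem_Icc] at hk ⊢
      omega
  have hSm : ∀ j ∈ Finset.Icc 1 J, ∀ i ∈ Finset.Icc 1 M, ∀ m (r : Fin (N m / 2 / M)),
      AEMeasurable (fun ω => Real.log (groupEnergy (N m) M (d m j) i r ω)) (P m) :=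
    fun j hj i hi m r => by
      have h1 := (hd m j hj _ (hk1 m _ (hk m i hi r))).1
      have h2 := (hd m j hj _ (hk2 m _ (hk m i hi r))).1
      exact Real.measurable_log.comp_aemeasurable
        (((h1.pow_const 2).add (h2.pow_const 2)).div_const 2)
  have hSlaw : ∀ j ∈ Finset.Icc 1 J, ∀ i ∈ Finset.Icc 1 M, ∀ m (r : Fin (N m / 2 / M)),
      (P m).map (fun ω => Real.log (groupEnergy (N m) M (d m j) i r ω)) =
        logExpMeasure.map (· + Real.log (levelScale H σ j)) := fun j hj i hi m r => by
    have hkr := hk m i hi r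
    have h1 := hd m j hj _ (hk1 m _ hkr)
    have h2 := hd m j hj _ (hk2 m _ hkr)
    exact map_log_midEnergy (levelScale_pos hσ j) h1.1 h2.1 h1.2 h2.2 (hpair m j hj _ hkr)
  have hSind : ∀ j ∈ Finset.Icc 1 J, ∀ i ∈ Finset.Icc 1 M, ∀ m,
      iIndepFun (fun (r : Fin (N m / 2 / M)) ω =>
        Real.log (groupEnergy (N m) M (d m j) i r ω)) (P m) := fun j hj i hi m =>
    (hgroup m j hj i hi).comp (fun _ => Real.log) fun _ => Real.measurable_log
  refine ⟨⟨fConst_pos hα hα' hp hp', fun j hj i hi => ?_⟩, fun S hS hS2 => ⟨fun m ω =>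
    hurstEstimator_eq α p S (N m) hM (d m) ω, ?_⟩⟩
  · simp_rw [hcast]
    exact generalTrimean_array_tendstoInDistribution hn (hSm j hj i hi) (hSlaw j hj i hi)
      (hSind j hj i hi) hp hp'
  · simp_rw [hurstEstimator_sub_eq hσ hS2 _ hM]
    -- Levels and groups may depend on each other arbitrarily: finite sums preserve convergence to
    -- zero in probability.
    exact TendstoZeroInProb.sum fun i hi => TendstoZeroInProb.const_mul
      (TendstoZeroInProb.sum fun j hj => (generalTrimean_array_consistent hn (hSm j (hS hj) i hi)
        (hSlaw j (hS hj) i hi) (hSind j (hS hj) i hi) hp hp').const_mul _) _
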